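/- **Setting.** A seller offers an unlimited-supply good with full externalities (a public good) to $n$ agents. Agent $i$ has a private value $v_i\ge 0$, drawn independently from a distribution with cumulative distribution function $F_i$; write $\mathcal F=\times_i F_i$, and put $F_i(\infty)=1$. If $S$ is the set of agents who purchase, an agent $i\in S$ who pays $p_i$ has utility $v_i-p_i$, and an agent $i\notin S$ has utility $v_i\,x_i(S)$, where $x_i(S)=1$ if $S\ne\emptyset$ and $x_i(\emptyset)=0$. Prices lie in $[0,\infty]$, thresholds lie in $[0,\infty]$, and agent $i$ buys when her value exceeds her threshold $T_i$; a fraction with denominator $0$ is read as $\infty$. *Simultaneous sale.* Given prices $\mathbf p=(p_1,\dots,p_n)$, an equilibrium is a vector $\mathbf T\in Eq(\mathcal F,\mathbf p)$ with $T_i=p_i/(1-\mathrm E[x_i(S)\mid i\notin S])$ for all $i$, where every agent $j$ is in $S$ independently with probability $1-F_j(T_j)$ (so $T_i=p_i/\prod_{j\ne i}F_j(T_j)$). Its revenue is $\sum_i p_i(1-F_i(T_i))$. Let $\underline{\mathcal R}_{\rm sim}(\mathcal F,\mathbf p)$ be the infimum of the revenue over $Eq(\mathcal F,\mathbf p)$,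 and let $\mathcal R^*_{\rm sim}(\mathcal F)$ be the supremum of the revenue over all $\mathbf p$ and all $\mathbf T\in Eq(\mathcal F,\mathbf p)$. *Sequential sale.* The agents arrive one by one in an order $\sigma$, are offered their prices upon arrival, observe the earlier purchases, and play the subgame perfect equilibrium: upon arrival, agent $i$ uses the threshold $p_i/(1-e)$, where $e$ is the conditional expectation of $x_i$ of the final set of purchasers given the set of earlier purchasers and that $i$ does not buy. Let $\mathcal R_{\rm seq}(\mathcal F,\sigma,\mathbf p)$ be the expected revenue and $\mathcal R^*_{\rm seq}(\mathcal F,\sigma)=\sup_{\mathbf p}\mathcal R_{\rm seq}(\mathcal F,\sigma,\mathbf p)$. *Regularity.* $F$ is regular if it has a density $f$ and the virtual value $\phi(v)=v-\frac{1-F(v)}{f(v)}$ is non-decreasing, that is, $\{f>0\}$ is an interval on which $\phi$ is non-decreasing. *Algorithms.* An algorithm is a single finite program for a real random access machine with exact arithmetic and comparison of real numbers, whose input is $n$ and which accesses $\mathcal F$ by oracle calls that return, for an agent $i$, the value $F_i(v)$ at a given real $v$ or the quantile $F_i^{-1}(q)=\inf\{v: F_i(v)\ge q\}$ at a given $q\in(0,1)$.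 Every instruction and every oracle call costs one step; polynomial time means that the number of steps is bounded by a polynomial in $n$. **Theorem.** Let $0\le p<\infty$ and let $\mathcal R=p\,(1-\prod_iF_i(p))$ be the revenue of the sale of a single private good at the anonymous price $p$. For the price vector $\mathbf p'=(p/2,\dots,p/2)$: (i) if all $F_i$ are atomless, then $Eq(\mathcal F,\mathbf p')\neq\emptyset$ and $\underline{\mathcal R}_{\rm sim}(\mathcal F,\mathbf p')\ge \mathcal R/4$; (ii) for every arrival order $\sigma$, $\mathcal R_{\rm seq}(\mathcal F,\sigma,\mathbf p')\ge\mathcal R/4$. **Corollary.** There is a polynomial-time algorithm that, for every $n$ and every product $\mathcal F$ of $n$ regular distributions on $[0,\infty)$, computes a single price $p\in[0,\infty)$ such that, for the non-discriminatory price vector $\mathbf p=(p,\dots,p)$: (i) $Eq(\mathcal F,\mathbf p)\ne\emptyset$ and $\underline{\mathcal R}_{\rm sim}(\mathcal F,\mathbf p)\ge \mathcal R^*_{\rm sim}(\mathcal F)/(4e)$; (ii) for every arrival order $\sigma$, $\mathcal R_{\rm seq}(\mathcal F,\sigma,\mathbf p)\ge \mathcal R^*_{\rm seq}(\mathcal F)/(4e)$,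 where $\mathcal R^*_{\rm seq}(\mathcal F)$ may be taken as $\mathcal R^*_{\rm seq}(\mathcal F,\sigma')$ for any order $\sigma'$. -/

import Mathlib

open MeasureTheory ProbabilityTheory
open scoped ENNReal NNReal

noncomputable section

namespace SocialGoods

/-! ## Value distributions -/

/-- The cumulative distribution function at an extended threshold: the probability that the value
does not exceed `T`, so that `F μ ∞ = 1`. It is the probability that an agent who buys exactly
when her value exceeds the threshold `T` does not buy. -/
def F (μ : Measure ℝ) (T : ℝ≥0∞) : ℝ≥0∞ := μ {v : ℝ | ENNReal.ofReal v ≤ T}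

/-- The virtual value `φ(v) = v - (1 - F(v)) / f(v)` of a distribution `μ` with density `f`. -/
def virtualValue (μ : Measure ℝ) (f : ℝ → ℝ) (v : ℝ) : ℝ := v - (1 - cdf μ v) / f v

/-- Regularity: `μ` has a density `f` and its virtual value is non-decreasing. Where `f` vanishes
below the top of the support the virtual value is `-∞`; so monotonicity means that the
set `{f > 0}` is an interval and that the virtual value is non-decreasing on it. -/
def IsRegular (μ : Measure ℝ) : Prop :=
  ∃ f : ℝ → ℝ, Measurable f ∧ (∀ v, 0 ≤ f v) ∧
    μ = volume.withDensity (fun v => ENNReal.ofReal (f v)) ∧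
    {v | 0 < f v}.OrdConnected ∧ MonotoneOn (virtualValue μ f) {v | 0 < f v}

/-- The quantile function `F⁻¹(q) = inf {v : q ≤ F(v)}` for `0 < q < 1` (set to `0` otherwise). -/
def quantile (μ : Measure ℝ) (q : ℝ) : ℝ :=
  if 0 < q ∧ q < 1 then sInf {v : ℝ | q ≤ cdf μ v} else 0

variable {n : ℕ}

/-! ## Externalities and thresholds -/

/-- Full externalities (public good): `x_i(S) = 1` if and only if `S` is non-empty. -/
def fullExt (_i : Fin n) (S : Finset (Fin n)) : ℝ≥0∞ := if S.Nonempty then 1 else 0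

/-- The value threshold `p / (1 - e)` of an agent who is offered the price `p` and expects the
fraction `e` of her value if she does not buy: she compares `v - p` with `v * e`.
A vanishing denominator gives the threshold `∞`. -/
def threshold (p e : ℝ≥0∞) : ℝ≥0∞ := if 1 - e = 0 then ∞ else p / (1 - e)

/-! ## Simultaneous sale -/

/-- The expectation of `g S`, where `S` is the set of purchasing agents under the thresholds `T`,
conditioned on agent `i` not purchasing: every other agent `j` is in `S` independently with
probability `1 - F_j(T_j)`. -/
def othersExp (𝓕 : Fin n → Measure ℝ) (T : Fin n → ℝ≥0∞) (i : Fin n)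
    (g : Finset (Fin n) → ℝ≥0∞) : ℝ≥0∞ :=
  ∑ S ∈ (Finset.univ.erase i).powerset,
    (∏ j ∈ S, (1 - F (𝓕 j) (T j))) * (∏ j ∈ (Finset.univ.erase i) \ S, F (𝓕 j) (T j)) * g S

/-- The set of equilibria (threshold vectors) induced by the price vector `p`, for the externality
functions `x`. -/
def simEq (x : Fin n → Finset (Fin n) → ℝ≥0∞) (𝓕 : Fin n → Measure ℝ) (p : Fin n → ℝ≥0∞) :
    Set (Fin n → ℝ≥0∞) :=
  {T | ∀ i, T i = threshold (p i) (othersExp 𝓕 T i (x i))}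

/-- The expected revenue of the simultaneous sale at the thresholds `T`. -/
def simRev (𝓕 : Fin n → Measure ℝ) (p T : Fin n → ℝ≥0∞) : ℝ≥0∞ :=
  ∑ i, p i * (1 - F (𝓕 i) (T i))

/-- The pessimistic revenue: the revenue in the worst equilibrium. -/
def pessSimRev (x : Fin n → Finset (Fin n) → ℝ≥0∞) (𝓕 : Fin n → Measure ℝ)
    (p : Fin n → ℝ≥0∞) : ℝ≥0∞ :=
  ⨅ T ∈ simEq x 𝓕 p, simRev 𝓕 p T

/-- The optimistic revenue: the revenue in the best equilibrium. -/
def optimSimRev (x : Fin n → Finset (Fin n) → ℝ≥0∞) (𝓕 : Fin n → Measure ℝ)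
    (p : Fin n → ℝ≥0∞) : ℝ≥0∞ :=
  ⨆ T ∈ simEq x 𝓕 p, simRev 𝓕 p T

/-- The benchmark of the simultaneous sale: best prices, best equilibrium. -/
def simOpt (x : Fin n → Finset (Fin n) → ℝ≥0∞) (𝓕 : Fin n → Measure ℝ) : ℝ≥0∞ :=
  ⨆ p : Fin n → ℝ≥0∞, optimSimRev x 𝓕 p

/-! ## Sequential sale -/

/-- The expectation of `g` at the final set of purchasing agents, when the agents in `S` have
already bought, the agents in the list are still to arrive (in that order), and they play the
subgame perfect equilibrium, which is computed by backward induction: the next agent `i` compares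
buying with the expected fraction of her value that she gets if she does not buy. -/
def seqExp (x : Fin n → Finset (Fin n) → ℝ≥0∞) (𝓕 : Fin n → Measure ℝ) (p : Fin n → ℝ≥0∞) :
    List (Fin n) → Finset (Fin n) → (Finset (Fin n) → ℝ≥0∞) → ℝ≥0∞
  | [], S, g => g S
  | i :: l, S, g =>
      F (𝓕 i) (threshold (p i) (seqExp x 𝓕 p l S (x i))) * seqExp x 𝓕 p l S g +
      (1 - F (𝓕 i) (threshold (p i) (seqExp x 𝓕 p l S (x i)))) * seqExp x 𝓕 p l (insert i S) g

/-- The expected payment, in the subgame perfect equilibrium, of the agents who are still to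
arrive (the list), when the agents in `S` have already bought. -/
def seqRevFrom (x : Fin n → Finset (Fin n) → ℝ≥0∞) (𝓕 : Fin n → Measure ℝ) (p : Fin n → ℝ≥0∞) :
    List (Fin n) → Finset (Fin n) → ℝ≥0∞
  | [], _ => 0
  | i :: l, S =>
      F (𝓕 i) (threshold (p i) (seqExp x 𝓕 p l S (x i))) * seqRevFrom x 𝓕 p l S +
      (1 - F (𝓕 i) (threshold (p i) (seqExp x 𝓕 p l S (x i)))) *
        (p i + seqRevFrom x 𝓕 p l (insert i S))

/-- The expected revenue of the sequential sale with the price vector `p`, in the order `σ`: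
agent `i` is the `σ i`-th to arrive. -/
def seqRev (x : Fin n → Finset (Fin n) → ℝ≥0∞) (𝓕 : Fin n → Measure ℝ) (σ : Equiv.Perm (Fin n))
    (p : Fin n → ℝ≥0∞) : ℝ≥0∞ :=
  seqRevFrom x 𝓕 p (List.ofFn fun k => σ.symm k) ∅

/-- The benchmark of the sequential sale in the order `σ`: best prices. -/
def seqOpt (x : Fin n → Finset (Fin n) → ℝ≥0∞) (𝓕 : Fin n → Measure ℝ)
    (σ : Equiv.Perm (Fin n)) : ℝ≥0∞ :=
  ⨆ p : Fin n → ℝ≥0∞, seqRev x 𝓕 σ p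

/-! ## Sale of a private good at an anonymous price -/

/-- The revenue `p * (1 - ∏ F_i(p))` from selling one private good at the anonymous price `p`. -/
def anonymousRev (𝓕 : Fin n → Measure ℝ) (p : ℝ≥0) : ℝ≥0∞ := p * (1 - ∏ i, F (𝓕 i) p)

/-! ## Algorithms

A real random access machine with oracle access to the distributions: registers for natural
numbers, which can only be cleared, copied, incremented and compared, registers for real numbers
with exact arithmetic, comparison and indirect addressing, and oracle calls that evaluate the
distribution function and the quantile function of an agent. Every instruction costs one step. -/

/-- Instructions. The letters `a b c` are addresses of registers and `t` is a jump target;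
`R[·]` are the real registers and `N[·]` the natural-number registers. -/
inductive Instr
  /-- `N[a] := 0` -/
  | natZero (a : ℕ)
  /-- `N[a] := N[a] + 1` -/
  | natSucc (a : ℕ)
  /-- `N[a] := N[b]` -/
  | natCopy (a b : ℕ)
  /-- go to `t` if `N[a] ≤ N[b]` -/
  | natJumpLe (a b t : ℕ)
  /-- `R[a] := q` -/
  | const (a : ℕ) (q : ℚ)
  /-- `R[a] := R[b] + R[c]` -/
  | add (a b c : ℕ)
  /-- `R[a] := R[b] - R[c]` -/
  | sub (a b c : ℕ)
  /-- `R[a] := R[b] * R[c]` -/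
  | mul (a b c : ℕ)
  /-- `R[a] := R[b] / R[c]` (with `0` for a division by `0`) -/
  | div (a b c : ℕ)
  /-- go to `t` if `R[a] ≤ R[b]` -/
  | jumpLe (a b t : ℕ)
  /-- `R[a] := R[N[b]]` -/
  | load (a b : ℕ)
  /-- `R[N[a]] := R[b]` -/
  | store (a b : ℕ)
  /-- `R[a] := F_i(R[c])` for the agent `i = N[b]` -/
  | evalCdf (a b c : ℕ)
  /-- `R[a] := F_i⁻¹(R[c])` for the agent `i = N[b]` -/
  | evalQuantile (a b c : ℕ)

/-- A program is a finite list of instructions. -/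
abbrev Program := List Instr

/-- A configuration: program counter, natural-number registers, real registers. -/
structure Config where
  pc : ℕ
  nat : ℕ → ℕ
  real : ℕ → ℝ

/-- The answer to the oracle call that evaluates the distribution function of agent `i`
(`0` if there is no such agent). -/
def oracleCdf (𝓕 : Fin n → Measure ℝ) (i : ℕ) (v : ℝ) : ℝ :=
  if h : i < n then cdf (𝓕 ⟨i, h⟩) v else 0

/-- The answer to the oracle call that evaluates the quantile function of agent `i`
(`0` if there is no such agent). -/
def oracleQuantile (𝓕 : Fin n → Measure ℝ) (i : ℕ) (q : ℝ) : ℝ :=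
  if h : i < n then quantile (𝓕 ⟨i, h⟩) q else 0

/-- Write a natural-number register and go to the next instruction. -/
def Config.setNat (s : Config) (a m : ℕ) : Config :=
  ⟨s.pc + 1, Function.update s.nat a m, s.real⟩

/-- Write a real register and go to the next instruction. -/
def Config.setReal (s : Config) (a : ℕ) (r : ℝ) : Config :=
  ⟨s.pc + 1, s.nat, Function.update s.real a r⟩

/-- The effect of one instruction. -/
def Instr.exec (𝓕 : Fin n → Measure ℝ) (s : Config) : Instr → Config
  | natZero a => s.setNat a 0
  | natSucc a => s.setNat a (s.nat a + 1)
  | natCopy a b => s.setNat a (s.nat b)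
  | natJumpLe a b t => if s.nat a ≤ s.nat b then { s with pc := t } else { s with pc := s.pc + 1 }
  | const a q => s.setReal a q
  | add a b c => s.setReal a (s.real b + s.real c)
  | sub a b c => s.setReal a (s.real b - s.real c)
  | mul a b c => s.setReal a (s.real b * s.real c)
  | div a b c => s.setReal a (s.real b / s.real c)
  | jumpLe a b t => if s.real a ≤ s.real b then { s with pc := t } else { s with pc := s.pc + 1 }
  | load a b => s.setReal a (s.real (s.nat b))
  | store a b => s.setReal (s.nat a) (s.real b)
  | evalCdf a b c => s.setReal a (oracleCdf 𝓕 (s.nat b) (s.real c))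
  | evalQuantile a b c => s.setReal a (oracleQuantile 𝓕 (s.nat b) (s.real c))

/-- One step. The machine has halted when the program counter is outside the program. -/
def Program.step (P : Program) (𝓕 : Fin n → Measure ℝ) (s : Config) : Config :=
  match P[s.pc]? with
  | some ins => ins.exec 𝓕 s
  | none => s

/-- The initial configuration: `N[0]` holds the number `n` of agents, all else is `0`. -/
def Config.init (n : ℕ) : Config := ⟨0, Function.update (fun _ => 0) 0 n, fun _ => 0⟩

/-- On the distributions `𝓕`, the program halts after at most `t` steps with output `R[0] = r`. -/
def Program.ComputesWithin (P : Program) (𝓕 : Fin n → Measure ℝ) (t : ℕ) (r : ℝ) : Prop :=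
  ∃ m ≤ t, P.length ≤ ((P.step 𝓕)^[m] (Config.init n)).pc ∧
    ((P.step 𝓕)^[m] (Config.init n)).real 0 = r

end SocialGoods

end

noncomputable section

namespace SocialGoods

open Filter Topology

/-! ## Distribution functions -/

section Distribution

variable {μ : Measure ℝ}

/-! An agent pays only to avert the event that nobody else buys: her threshold is her price divided
by the probability of that event.

Lower bound. Charge everyone `c`. Either no sale has probability at most 1/2, and the revenue is at
least `c / 2`; or all relevant thresholds are at most `2 * c`, and a sale is at least as likely as
some value exceeding `2 * c`. So the revenue is at least `c * min (1 / 2) (1 - ∏ i, F (𝓕 i) (2 *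
c))` in every equilibrium (`le_simRev`) and every arrival order (`le_seqRev`). Taking `c = p / 2`
gives the theorem.

Upper bound. Writing each price as threshold times probability turns the revenue of either sale into
`soloRev`. Regularity makes the revenue curve concave, so `p (1 - F(p)) / F(p)` is non-increasing
(`IsRegular.mul_survival_mul_cdf_le`). Hence `soloRev` is at most `p * max 1 (1 / q - 1)` for every
`p` with `q = ∏ F_i(p) > 0` (`soloRev_le`). If `3/10 < q < 4/5`, the price `p / 2` is within the
factor `4e` of this bound (`benchmark_div_le`).

Algorithm. Some quantile at a multiple of `1 / (4n)` has `q` in `[1/2, 3/4]`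
(`exists_quantile_prod_cdf_mem`), so searching all of them takes polynomially many steps. Equilibria
exist because they arise from minimisers of a potential (`exists_balanced`). -/

lemma F_mono (μ : Measure ℝ) : Monotone (F μ) :=
  fun _ _ h => measure_mono fun _ hv => le_trans hv h

lemma F_le_one (μ : Measure ℝ) [IsProbabilityMeasure μ] (T : ℝ≥0∞) : F μ T ≤ 1 := prob_le_one

lemma F_top (μ : Measure ℝ) [IsProbabilityMeasure μ] : F μ ∞ = 1 := by
  simp [F]

lemma F_coe (μ : Measure ℝ) [IsProbabilityMeasure μ] (t : ℝ≥0) :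
    F μ t = ENNReal.ofReal (cdf μ t) := by
  rw [ofReal_cdf, F]
  congr 1
  ext v
  simp [ENNReal.ofReal_le_iff_le_toReal]

lemma F_ne_top (μ : Measure ℝ) [IsProbabilityMeasure μ] (T : ℝ≥0∞) : F μ T ≠ ∞ :=
  ((F_le_one μ T).trans_lt ENNReal.one_lt_top).ne

lemma cdf_eq_zero_of_neg [IsProbabilityMeasure μ] (h0 : μ (Set.Iio 0) = 0) {t : ℝ} (ht : t < 0) :
    cdf μ t = 0 := by
  rw [cdf_eq_real, measureReal_def, measure_mono_null (Set.Iic_subset_Iio.2 ht) h0]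
  simp

lemma continuous_cdf [IsProbabilityMeasure μ] (ha : ∀ v, μ {v} = 0) : Continuous (cdf μ) := by
  refine continuous_iff_continuousAt.2 fun x => ?_
  rw [(monotone_cdf μ).continuousAt_iff_leftLim_eq_rightLim, (cdf μ).rightLim_eq]
  have h := (cdf μ).measure_singleton x
  rw [measure_cdf, ha x, eq_comm, ENNReal.ofReal_eq_zero] at h
  exact le_antisymm ((monotone_cdf μ).leftLim_le le_rfl) (by linarith)

lemma cdf_zero [IsProbabilityMeasure μ] (h0 : μ (Set.Iio 0) = 0) (ha : ∀ v, μ {v} = 0) :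
    cdf μ 0 = 0 := by
  have : μ (Set.Iic 0) = 0 := by
    rw [← Set.Iio_union_right]
    exact measure_union_null h0 (ha 0)
  rw [cdf_eq_real, measureReal_def, this]
  simp

lemma cdf_quantile [IsProbabilityMeasure μ] (hc : Continuous (cdf μ)) {q : ℝ} (hq : 0 < q ∧ q < 1) :
    cdf μ (quantile μ q) = q := by
  rw [quantile, if_pos hq]
  set S := {v : ℝ | q ≤ cdf μ v} with hS
  have hne : S.Nonempty :=
    ((tendsto_cdf_atTop μ).eventually (lt_mem_nhds hq.2)).exists.imp fun v hv => hv.le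
  obtain ⟨b, hb⟩ := ((tendsto_cdf_atBot μ).eventually (gt_mem_nhds hq.1)).exists
  have hbd : BddBelow S := ⟨b, fun v hv => by
    by_contra h
    exact absurd (monotone_cdf μ (not_le.1 h).le) (not_le.2 (hb.trans_le hv))⟩
  have hcl : IsClosed S := isClosed_le continuous_const hc
  refine le_antisymm ?_ (hcl.csInf_mem hne hbd)
  have : Tendsto (cdf μ) (𝓝[<] sInf S) (𝓝 (cdf μ (sInf S))) :=
    (hc.tendsto _).mono_left nhdsWithin_le_nhds
  refine le_of_tendsto this ?_
  filter_upwards [self_mem_nhdsWithin] with v hv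
  by_contra h
  exact absurd (csInf_le hbd (not_le.1 h).le) (not_le.2 hv)

end Distribution

/-! ## Regular distributions -/

section Regular

variable {μ : Measure ℝ} [IsProbabilityMeasure μ] {f : ℝ → ℝ}

lemma IsRegular.singleton_eq_zero {μ : Measure ℝ} (h : IsRegular μ) (v : ℝ) : μ {v} = 0 := by
  obtain ⟨f, -, -, hμ, -⟩ := h
  rw [hμ]
  exact withDensity_absolutelyContinuous _ _ (measure_singleton v)

lemma integrable_of_eq_withDensity (hf : Measurable f) (hf0 : ∀ v, 0 ≤ f v)
    (hμ : μ = volume.withDensity fun v => ENNReal.ofReal (f v)) : Integrable f := by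
  refine ⟨hf.aestronglyMeasurable, ?_⟩
  rw [hasFiniteIntegral_iff_ofReal (ae_of_all _ hf0), ← setLIntegral_univ,
    ← withDensity_apply _ MeasurableSet.univ, ← hμ]
  exact measure_lt_top _ _

lemma cdf_sub_cdf_eq_integral (hf : Measurable f) (hf0 : ∀ v, 0 ≤ f v)
    (hμ : μ = volume.withDensity fun v => ENNReal.ofReal (f v)) (a b : ℝ) :
    cdf μ b - cdf μ a = ∫ t in a..b, f t := by
  have hi := integrable_of_eq_withDensity hf hf0 hμ
  have h (x : ℝ) : cdf μ x = ∫ t in Set.Iic x, f t := by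
    rw [cdf_eq_real, measureReal_def, hμ, withDensity_apply _ measurableSet_Iic,
      integral_eq_lintegral_of_nonneg_ae (ae_of_all _ hf0) hf.aestronglyMeasurable]
  rw [h, h, intervalIntegral.integral_Iic_sub_Iic hi.integrableOn hi.integrableOn]

/-- Integration by parts for absolutely continuous functions: the integrand is almost everywhere the
derivative of `(t - s) * (1 - cdf μ t)`, without any continuity of `f`. -/
lemma integral_survival_sub_density (hf : Measurable f) (hf0 : ∀ v, 0 ≤ f v)
    (hμ : μ = volume.withDensity fun v => ENNReal.ofReal (f v)) (s : ℝ) (a b : ℝ) :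
    ∫ t in a..b, ((1 - cdf μ t) - (t - s) * f t) =
      (b - s) * (1 - cdf μ b) - (a - s) * (1 - cdf μ a) := by
  have hi := (integrable_of_eq_withDensity hf hf0 hμ)
  have hii : IntervalIntegrable f volume a b := hi.intervalIntegrable
  set G : ℝ → ℝ := fun x => ∫ t in a..x, f t with hG
  have hGac : AbsolutelyContinuousOnInterval G a b :=
    hii.absolutelyContinuousOnInterval_intervalIntegral (by simp)
  have hlin : AbsolutelyContinuousOnInterval (fun t : ℝ => t - s) a b := by
    refine ContDiffOn.absolutelyContinuousOnInterval ?_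
    fun_prop
  have key := hlin.integral_deriv_mul_eq_sub hGac
  have hderiv : ∀ᵐ t, t ∈ Set.uIoc a b →
      deriv (fun t : ℝ => t - s) t * G t + (t - s) * deriv G t = G t + (t - s) * f t := by
    have := LocallyIntegrable.ae_hasDerivAt_integral hi.locallyIntegrable
    filter_upwards [this] with t ht _
    rw [(ht a).deriv]
    simp
  rw [intervalIntegral.integral_congr_ae hderiv] at key
  have hGeq (t : ℝ) : cdf μ t = cdf μ a + G t := by
    have := cdf_sub_cdf_eq_integral hf hf0 hμ a t
    simp only [hG]
    linarith
  have hGi : IntervalIntegrable G volume a b := hGac.continuousOn.intervalIntegrable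
  have hfi : IntervalIntegrable (fun t => (t - s) * f t) volume a b :=
    hii.continuousOn_mul (by fun_prop)
  have h1 : ∫ t in a..b, ((1 - cdf μ t) - (t - s) * f t) =
      ∫ t in a..b, ((1 - cdf μ a) - (G t + (t - s) * f t)) :=
    intervalIntegral.integral_congr fun t _ => by
      rw [hGeq t]; ring
  rw [h1, intervalIntegral.integral_sub intervalIntegrable_const (hGi.add hfi), key, hGeq b]
  have : G a = 0 := by simp [hG]
  rw [this, intervalIntegral.integral_const, smul_eq_mul]
  ring

lemma exists_density_pos_le
    (hμ : μ = volume.withDensity fun v => ENNReal.ofReal (f v)) {p : ℝ} (hp : cdf μ p ≠ 0) :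
    ∃ t ≤ p, 0 < f t := by
  by_contra! h
  refine hp ?_
  have : μ (Set.Iic p) = 0 := by
    rw [hμ, withDensity_apply _ measurableSet_Iic,
      setLIntegral_congr_fun (g := fun _ => 0) measurableSet_Iic
        fun t ht => ENNReal.ofReal_of_nonpos (h t ht)]
    simp
  rw [cdf_eq_real, measureReal_def, this]
  simp

lemma exists_density_pos_gt
    (hμ : μ = volume.withDensity fun v => ENNReal.ofReal (f v)) {p : ℝ} (hp : cdf μ p ≠ 1) :
    ∃ t, p < t ∧ 0 < f t := by
  by_contra! h
  refine hp ?_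
  have : μ (Set.Iic p)ᶜ = 0 := by
    rw [Set.compl_Iic, hμ, withDensity_apply _ measurableSet_Ioi,
      setLIntegral_congr_fun (g := fun _ => 0) measurableSet_Ioi
        fun t ht => ENNReal.ofReal_of_nonpos (h t ht)]
    simp
  rw [cdf_eq_real, measureReal_def, (prob_compl_eq_zero_iff measurableSet_Iic).1 this]
  simp

/-- For a regular distribution the odds-weighted price `p (1 - F(p)) / F(p)` is non-increasing. -/
lemma IsRegular.mul_survival_mul_cdf_le {μ : Measure ℝ} [IsProbabilityMeasure μ]
    (h : IsRegular μ) (h0 : μ (Set.Iio 0) = 0) {p v : ℝ} (hp : 0 ≤ p) (hpv : p ≤ v) :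
    v * (1 - cdf μ v) * cdf μ p ≤ p * (1 - cdf μ p) * cdf μ v := by
  have hzero := cdf_zero h0 h.singleton_eq_zero
  obtain ⟨f, hf, hf0, hμ, hI, hφ⟩ := h
  have hp0 := cdf_nonneg μ p
  have hv0 := cdf_nonneg μ v
  have hp1 := cdf_le_one μ p
  have hmono := monotone_cdf μ hpv
  -- Outside these two degenerate cases there is density both at or below `p` and above `v`, so it
  -- is positive on all of `[p, v]`.
  by_cases hFp : cdf μ p = 0
  · rw [hFp, mul_zero]
    exact mul_nonneg (by nlinarith) hv0
  by_cases hFv : cdf μ v = 1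
  · rw [hFv]
    nlinarith
  obtain ⟨t₁, ht₁, hft₁⟩ := exists_density_pos_le hμ hFp
  obtain ⟨t₂, ht₂, hft₂⟩ := exists_density_pos_gt hμ hFv
  have hmem : ∀ t ∈ Set.Icc p v, 0 < f t := fun t ht =>
    hI.out hft₁ hft₂ ⟨ht₁.trans ht.1, ht.2.trans ht₂.le⟩
  have hpI := hmem p ⟨le_rfl, hpv⟩
  -- `s` is the slope of the revenue curve at `p`. Where `f > 0` the integrand below equals `(s -
  -- φ(t)) f(t)`, so its sign changes at `p`: the tangent lies above the curve.
  set s := virtualValue μ f p with hs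
  have hpt (t : ℝ) (ht : 0 < f t) : (1 - cdf μ t) = (t - virtualValue μ f t) * f t := by
    rw [virtualValue]; field_simp; ring
  have hlow := integral_survival_sub_density hf hf0 hμ s 0 p
  have hhigh := integral_survival_sub_density hf hf0 hμ s p v
  have hlow' : 0 ≤ ∫ t in (0 : ℝ)..p, ((1 - cdf μ t) - (t - s) * f t) := by
    refine intervalIntegral.integral_nonneg hp fun t ht => ?_
    rcases (hf0 t).eq_or_lt with h | h
    · rw [← h]; linarith [cdf_le_one μ t]
    · rw [hpt t h]
      nlinarith [hφ h hpI ht.2]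
  have hhigh' : ∫ t in p..v, ((1 - cdf μ t) - (t - s) * f t) ≤ 0 := by
    rw [← neg_nonneg, ← intervalIntegral.integral_neg]
    refine intervalIntegral.integral_nonneg hpv fun t ht => ?_
    rw [hpt t (hmem t ht)]
    nlinarith [hφ hpI (hmem t ht) ht.1, hmem t ht]
  rw [hlow, hzero] at hlow'
  rw [hhigh] at hhigh'
  -- With `R(t) = t (1 - F(t))`, the two tangent inequalities read `0 ≤ R(p) + s F(p)` and `R(v) ≤
  -- R(p) + s (F(p) - F(v))`. Eliminating `s` gives the claim.
  nlinarith [mul_le_mul_of_nonneg_left (sub_nonpos.1 hhigh') hp0,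
    mul_nonneg hlow' (sub_nonneg.2 hmono)]

end Regular

variable {n : ℕ}

/-! ## Thresholds under full externalities -/

section Thresholds

variable {𝓕 : Fin n → Measure ℝ}

lemma fullExt_of_nonempty (i : Fin n) {S : Finset (Fin n)} (h : S.Nonempty) : fullExt i S = 1 :=
  if_pos h

lemma fullExt_empty (i : Fin n) : fullExt i ∅ = 0 := by simp [fullExt]

lemma threshold_one (p : ℝ≥0∞) : threshold p 1 = ∞ := by simp [threshold]

lemma threshold_one_sub {a : ℝ≥0∞} (ha : a ≤ 1) (p : ℝ≥0∞) :
    threshold p (1 - a) = if a = 0 then ∞ else p / a := by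
  rw [threshold, ENNReal.sub_sub_cancel ENNReal.one_ne_top ha]

lemma threshold_le_of_half_le {a : ℝ≥0∞} (ha : a ≤ 1) (h : 1 / 2 ≤ a) (c : ℝ≥0∞) :
    threshold c (1 - a) ≤ 2 * c := by
  have ha0 : a ≠ 0 := by
    rintro rfl
    simp at h
  rw [threshold_one_sub ha, if_neg ha0]
  calc c / a ≤ c / (1 / 2) := ENNReal.div_le_div_left h c
    _ = 2 * c := by rw [one_div, div_eq_mul_inv, inv_inv, mul_comm]

/-- The price can be recovered from the threshold, up to agents who never buy. -/
lemma price_mul_one_sub_F (μ : Measure ℝ) [IsProbabilityMeasure μ] {a : ℝ≥0∞} (ha : a ≤ 1)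
    (p : ℝ≥0∞) :
    p * (1 - F μ (threshold p (1 - a))) =
      threshold p (1 - a) * (1 - F μ (threshold p (1 - a))) * a := by
  rw [threshold_one_sub ha]
  split_ifs with h
  · simp [F_top]
  · rw [mul_right_comm, ENNReal.div_mul_cancel h (ha.trans_lt ENNReal.one_lt_top).ne]

variable [∀ i, IsProbabilityMeasure (𝓕 i)]

lemma prod_F_le_one (T : Fin n → ℝ≥0∞) (s : Finset (Fin n)) : ∏ j ∈ s, F (𝓕 j) (T j) ≤ 1 :=
  Finset.prod_le_one' fun _ _ => F_le_one _ _

/-- Expanding `∏ ((1 - F_j) + F_j) = 1` over subsets, only the empty set has externality 0. -/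
lemma othersExp_fullExt (T : Fin n → ℝ≥0∞) (i : Fin n) :
    othersExp 𝓕 T i (fullExt i) = 1 - ∏ j ∈ Finset.univ.erase i, F (𝓕 j) (T j) := by
  set s := (Finset.univ : Finset (Fin n)).erase i
  have htot : ∑ S ∈ s.powerset,
      (∏ j ∈ S, (1 - F (𝓕 j) (T j))) * (∏ j ∈ s \ S, F (𝓕 j) (T j)) = 1 := by
    rw [← Finset.prod_add]
    exact Finset.prod_eq_one fun j _ => tsub_add_cancel_of_le (F_le_one _ _)
  rw [← Finset.sum_erase_add _ _ (Finset.empty_mem_powerset s)] at htot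
  have hsum : othersExp 𝓕 T i (fullExt i) = ∑ S ∈ s.powerset.erase ∅,
      (∏ j ∈ S, (1 - F (𝓕 j) (T j))) * (∏ j ∈ s \ S, F (𝓕 j) (T j)) := by
    rw [othersExp, ← Finset.sum_erase_add _ _ (Finset.empty_mem_powerset s), fullExt_empty,
      mul_zero, add_zero]
    refine Finset.sum_congr rfl fun S hS => ?_
    rw [fullExt_of_nonempty _ (Finset.nonempty_iff_ne_empty.2 (Finset.ne_of_mem_erase hS)), mul_one]
  rw [hsum]
  refine ENNReal.eq_sub_of_add_eq ((prod_F_le_one T s).trans_lt ENNReal.one_lt_top).ne ?_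
  simpa using htot

lemma mem_simEq_fullExt {p T : Fin n → ℝ≥0∞} :
    T ∈ simEq fullExt 𝓕 p ↔
      ∀ i, T i = threshold (p i) (1 - ∏ j ∈ Finset.univ.erase i, F (𝓕 j) (T j)) := by
  simp only [← othersExp_fullExt]
  exact Iff.rfl

/-- Given the thresholds `T`, the expected revenue if an agent who is the only one whose value
exceeds her threshold pays her threshold. -/
def soloRev (𝓕 : Fin n → Measure ℝ) (T : Fin n → ℝ≥0∞) (s : Finset (Fin n)) : ℝ≥0∞ :=
  ∑ i ∈ s, T i * (1 - F (𝓕 i) (T i)) * ∏ j ∈ s.erase i, F (𝓕 j) (T j)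

lemma simRev_eq_soloRev {p T : Fin n → ℝ≥0∞} (hT : T ∈ simEq fullExt 𝓕 p) :
    simRev 𝓕 p T = soloRev 𝓕 T Finset.univ := by
  rw [mem_simEq_fullExt] at hT
  refine Finset.sum_congr rfl fun i _ => ?_
  have := price_mul_one_sub_F (𝓕 i) (prod_F_le_one (𝓕 := 𝓕) T (Finset.univ.erase i)) (p i)
  rwa [← hT i] at this

lemma one_sub_prod_le_sum {ι : Type*} (s : Finset ι) (a : ι → ℝ≥0∞) (ha : ∀ i ∈ s, a i ≤ 1) :
    1 - ∏ i ∈ s, a i ≤ ∑ i ∈ s, (1 - a i) := by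
  classical
  induction s using Finset.induction_on with
  | empty => simp
  | insert i s hi ih =>
    rw [Finset.prod_insert hi, Finset.sum_insert hi]
    have h1 := ha i (Finset.mem_insert_self i s)
    have h2 := ih fun j hj => ha j (Finset.mem_insert_of_mem hj)
    calc 1 - a i * ∏ j ∈ s, a j ≤ (1 - a i) + (1 - ∏ j ∈ s, a j) := by
          rw [tsub_le_iff_right]
          calc (1 : ℝ≥0∞) = (1 - a i) + a i * 1 := by rw [mul_one, tsub_add_cancel_of_le h1]
            _ ≤ (1 - a i) + a i * ((1 - ∏ j ∈ s, a j) + ∏ j ∈ s, a j) := by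
                gcongr; exact le_tsub_add
            _ ≤ (1 - a i) + (1 * (1 - ∏ j ∈ s, a j) + a i * ∏ j ∈ s, a j) := by
                rw [mul_add]; gcongr
            _ = _ := by rw [one_mul, add_assoc]
      _ ≤ _ := by gcongr

/-- Revenue guarantee of the anonymous price `c`, in every equilibrium of the simultaneous sale. -/
lemma le_simRev {c : ℝ≥0∞} {T : Fin n → ℝ≥0∞} (hT : T ∈ simEq fullExt 𝓕 fun _ => c) :
    c * min (1 / 2) (1 - ∏ i, F (𝓕 i) (2 * c)) ≤ simRev 𝓕 (fun _ => c) T := by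
  rw [mem_simEq_fullExt] at hT
  rw [simRev, ← Finset.mul_sum]
  refine mul_le_mul_right ?_ c
  refine le_trans ?_ (one_sub_prod_le_sum Finset.univ _ fun i _ => F_le_one (𝓕 i) (T i))
  rcases le_total (∏ i, F (𝓕 i) (T i)) (1 / 2) with h | h
  -- Dichotomy on the probability of no sale: if it is small, sales are frequent; if it is large,
  -- dividing by it at most doubles the price.
  · refine (min_le_left _ _).trans ?_
    calc (1 / 2 : ℝ≥0∞) = 1 - 1 / 2 := by simp
      _ ≤ _ := tsub_le_tsub_left h 1
  · refine (min_le_right _ _).trans (tsub_le_tsub_left ?_ 1)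
    refine Finset.prod_le_prod' fun i _ => F_mono _ ?_
    rw [hT i]
    refine threshold_le_of_half_le (prod_F_le_one T _) (h.trans ?_) c
    rw [← Finset.mul_prod_erase _ _ (Finset.mem_univ i)]
    exact mul_le_of_le_one_left' (F_le_one _ _)

/-! ## Sequential sale -/

lemma seqExp_fullExt_of_nonempty (p : Fin n → ℝ≥0∞) (k : Fin n) (l : List (Fin n))
    {S : Finset (Fin n)} (hS : S.Nonempty) : seqExp fullExt 𝓕 p l S (fullExt k) = 1 := by
  induction l generalizing S with
  | nil => exact fullExt_of_nonempty k hS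
  | cons i l ih =>
    rw [seqExp, ih hS, ih (Finset.insert_nonempty _ _), mul_one, mul_one,
      add_tsub_cancel_of_le (F_le_one _ _)]

/-- After one purchase everyone free-rides: the expected fraction is 1, so the threshold is
infinite. -/
lemma seqRevFrom_of_nonempty (p : Fin n → ℝ≥0∞) (l : List (Fin n))
    {S : Finset (Fin n)} (hS : S.Nonempty) : seqRevFrom fullExt 𝓕 p l S = 0 := by
  have key : ∀ i, seqExp fullExt 𝓕 p l S (fullExt i) = 1 := fun i =>
    seqExp_fullExt_of_nonempty p i l hS
  induction l generalizing S with
  | nil => rfl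
  | cons i l ih =>
    have h1 := fun k => seqExp_fullExt_of_nonempty (𝓕 := 𝓕) p k l hS
    rw [seqRevFrom, ih hS h1, h1 i, threshold_one, F_top]
    simp

/-- The probability that none of the agents in the list buys, when nobody has bought before. -/
def noSale (𝓕 : Fin n → Measure ℝ) (p : Fin n → ℝ≥0∞) : List (Fin n) → ℝ≥0∞
  | [] => 1
  | i :: l => F (𝓕 i) (threshold (p i) (1 - noSale 𝓕 p l)) * noSale 𝓕 p l

lemma noSale_le_one (p : Fin n → ℝ≥0∞) (l : List (Fin n)) : noSale 𝓕 p l ≤ 1 := by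
  induction l with
  | nil => exact le_rfl
  | cons i l ih => exact mul_le_one' (F_le_one _ _) ih

lemma seqExp_empty (p : Fin n → ℝ≥0∞) (k : Fin n) (l : List (Fin n)) :
    seqExp fullExt 𝓕 p l ∅ (fullExt k) = 1 - noSale 𝓕 p l := by
  induction l generalizing k with
  | nil => simp [seqExp, fullExt_empty, noSale]
  | cons i l ih =>
    rw [seqExp, ih, ih, seqExp_fullExt_of_nonempty p k l (Finset.insert_nonempty _ _), noSale,
      mul_one]
    set a := F (𝓕 i) (threshold (p i) (1 - noSale 𝓕 p l))
    have ha : a ≤ 1 := F_le_one _ _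
    have hb := noSale_le_one (𝓕 := 𝓕) p l
    have hab : a * noSale 𝓕 p l ≠ ∞ :=
      ((mul_le_one' ha hb).trans_lt ENNReal.one_lt_top).ne
    refine ENNReal.eq_sub_of_add_eq hab ?_
    rw [add_right_comm, ← mul_add, tsub_add_cancel_of_le hb, mul_one, add_tsub_cancel_of_le ha]

lemma seqRevFrom_cons (p : Fin n → ℝ≥0∞) (i : Fin n) (l : List (Fin n)) :
    seqRevFrom fullExt 𝓕 p (i :: l) ∅ =
      F (𝓕 i) (threshold (p i) (1 - noSale 𝓕 p l)) * seqRevFrom fullExt 𝓕 p l ∅ +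
      (1 - F (𝓕 i) (threshold (p i) (1 - noSale 𝓕 p l))) * p i := by
  rw [seqRevFrom, seqExp_empty, seqRevFrom_of_nonempty p l (Finset.insert_nonempty _ _), add_zero]

/-- The thresholds are those used along the path without a sale. A new first agent contributes the
factor `F_i` to every later solo term, and her own price is her threshold times the later no-sale
probability. -/
lemma exists_thresholds_seq (p : Fin n → ℝ≥0∞) (l : List (Fin n)) (hl : l.Nodup) :
    ∃ T : Fin n → ℝ≥0∞, noSale 𝓕 p l = ∏ j ∈ l.toFinset, F (𝓕 j) (T j) ∧
      seqRevFrom fullExt 𝓕 p l ∅ = soloRev 𝓕 T l.toFinset := by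
  induction l with
  | nil => exact ⟨fun _ => 0, by simp [noSale], by simp [seqRevFrom, soloRev]⟩
  | cons i l ih =>
    obtain ⟨hi, hl⟩ := List.nodup_cons.1 hl
    obtain ⟨T, hT1, hT2⟩ := ih hl
    have hi' : i ∉ l.toFinset := by simpa using hi
    set t := threshold (p i) (1 - noSale 𝓕 p l) with ht
    set T' := Function.update T i t with hT'
    have hTi : T' i = t := Function.update_self ..
    have hTj : ∀ j ∈ l.toFinset, T' j = T j := fun j hj =>
      Function.update_of_ne (fun h : j = i => hi' (h ▸ hj)) _ _
    have hprod : ∀ s ⊆ l.toFinset, ∏ j ∈ s, F (𝓕 j) (T' j) = ∏ j ∈ s, F (𝓕 j) (T j) :=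
      fun s hs => Finset.prod_congr rfl fun j hj => by rw [hTj j (hs hj)]
    refine ⟨T', ?_, ?_⟩
    · rw [List.toFinset_cons, Finset.prod_insert hi', hprod _ subset_rfl, ← hT1, hTi, noSale]
    · have hpr := price_mul_one_sub_F (𝓕 i) (noSale_le_one (𝓕 := 𝓕) p l) (p i)
      rw [← ht] at hpr
      rw [seqRevFrom_cons, ← ht, hT2, mul_comm (1 - _) (p i), hpr, add_comm, soloRev, soloRev,
        List.toFinset_cons, Finset.sum_insert hi', hTi, Finset.erase_insert hi',
        hprod _ subset_rfl, ← hT1, Finset.mul_sum]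
      congr 1
      refine Finset.sum_congr rfl fun j hj => ?_
      have hij : i ≠ j := fun h => hi' (h ▸ hj)
      rw [hTj j hj, Finset.erase_insert_of_ne hij,
        Finset.prod_insert (fun h => hi' (Finset.mem_of_mem_erase h)),
        hprod _ (Finset.erase_subset _ _), hTi]
      ring

lemma toFinset_arrivals (σ : Equiv.Perm (Fin n)) :
    (List.ofFn fun k => σ.symm k).Nodup ∧
      (List.ofFn fun k => σ.symm k).toFinset = Finset.univ := by
  refine ⟨List.nodup_ofFn.2 σ.symm.injective, ?_⟩
  ext i
  simp [List.mem_ofFn, σ.symm.surjective i]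

lemma exists_seqRev_eq_soloRev (σ : Equiv.Perm (Fin n)) (p : Fin n → ℝ≥0∞) :
    ∃ T : Fin n → ℝ≥0∞, seqRev fullExt 𝓕 σ p = soloRev 𝓕 T Finset.univ := by
  obtain ⟨hl, hs⟩ := toFinset_arrivals σ
  obtain ⟨T, -, hT⟩ := exists_thresholds_seq (𝓕 := 𝓕) p _ hl
  exact ⟨T, by rw [seqRev, hT, hs]⟩

/-- At most one agent ever buys. -/
lemma seqRevFrom_const (c : ℝ≥0∞) (l : List (Fin n)) :
    seqRevFrom fullExt 𝓕 (fun _ => c) l ∅ = c * (1 - noSale 𝓕 (fun _ => c) l) := by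
  induction l with
  | nil => simp [seqRevFrom, noSale]
  | cons i l ih =>
    rw [seqRevFrom_cons, ih, noSale]
    set a := F (𝓕 i) (threshold c (1 - noSale 𝓕 (fun _ => c) l))
    have ha : a ≤ 1 := F_le_one _ _
    have hb := noSale_le_one (𝓕 := 𝓕) (fun _ => c) l
    set b := noSale 𝓕 (fun _ => c) l
    have hab : a * b ≠ ∞ := ((mul_le_one' ha hb).trans_lt ENNReal.one_lt_top).ne
    have : a * (1 - b) + (1 - a) = 1 - a * b := by
      refine ENNReal.eq_sub_of_add_eq hab ?_
      rw [add_right_comm, ← mul_add, tsub_add_cancel_of_le hb, mul_one, add_tsub_cancel_of_le ha]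
    rw [← this]
    ring

/-- The lower bound 1/2 passes to every tail of the list, so each threshold on the no-sale path is
at most `2 * c`. -/
lemma noSale_le_prod (c : ℝ≥0∞) (l : List (Fin n)) (hl : 1 / 2 ≤ noSale 𝓕 (fun _ => c) l) :
    noSale 𝓕 (fun _ => c) l ≤ (l.map fun i => F (𝓕 i) (2 * c)).prod := by
  induction l with
  | nil => simp [noSale]
  | cons i l ih =>
    rw [noSale] at hl
    have h : 1 / 2 ≤ noSale 𝓕 (fun _ => c) l := hl.trans (mul_le_of_le_one_left' (F_le_one _ _))
    rw [noSale, List.map_cons, List.prod_cons]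
    exact mul_le_mul' (F_mono _ (threshold_le_of_half_le (noSale_le_one _ _) h c)) (ih h)

/-- Revenue guarantee of the anonymous price `c` in the sequential sale. -/
lemma le_seqRev (σ : Equiv.Perm (Fin n)) (c : ℝ≥0∞) :
    c * min (1 / 2) (1 - ∏ i, F (𝓕 i) (2 * c)) ≤ seqRev fullExt 𝓕 σ fun _ => c := by
  obtain ⟨hl, hs⟩ := toFinset_arrivals σ
  rw [seqRev, seqRevFrom_const]
  refine mul_le_mul_right ?_ c
  set l := List.ofFn fun k => σ.symm k
  rcases le_total (noSale 𝓕 (fun _ => c) l) (1 / 2) with h | h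
  · refine (min_le_left _ _).trans ?_
    calc (1 / 2 : ℝ≥0∞) = 1 - 1 / 2 := by simp
      _ ≤ _ := tsub_le_tsub_left h 1
  · refine (min_le_right _ _).trans (tsub_le_tsub_left ?_ 1)
    rw [← hs, List.prod_toFinset _ hl]
    exact noSale_le_prod c l h

lemma anonymousRev_div_four_le (𝓕 : Fin n → Measure ℝ) (p : ℝ≥0) :
    anonymousRev 𝓕 p / 4 ≤ (p / 2 : ℝ≥0∞) * min (1 / 2) (1 - ∏ i, F (𝓕 i) (2 * (p / 2))) := by
  have h2 : (2 : ℝ≥0∞) * (p / 2) = p := ENNReal.mul_div_cancel two_ne_zero ENNReal.ofNat_ne_top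
  rw [h2, anonymousRev]
  set s : ℝ≥0∞ := 1 - ∏ i, F (𝓕 i) p
  -- The factor 4 is 2 from halving the price and 2 from this bound, which uses `s ≤ 1`.
  have hs : s / 2 ≤ min (1 / 2) s :=
    le_min (ENNReal.div_le_div_right tsub_le_self 2) ENNReal.half_le_self
  calc (p : ℝ≥0∞) * s / 4 = p / 2 * (s / 2) := by
        rw [show (4 : ℝ≥0∞) = 2 * 2 by norm_num, div_eq_mul_inv, div_eq_mul_inv, div_eq_mul_inv,
          ENNReal.mul_inv (by simp) (by simp)]
        ring
    _ ≤ _ := mul_le_mul_right hs _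

end Thresholds

/-! ## The benchmark is bounded by any price with a moderate probability of sale -/

section UpperBound

variable {ι : Type*}

lemma one_add_sum_le_prod_one_add (s : Finset ι) (x : ι → ℝ) (hx : ∀ i, 0 ≤ x i) :
    1 + ∑ i ∈ s, x i ≤ ∏ i ∈ s, (1 + x i) := by
  classical
  induction s using Finset.induction_on with
  | empty => simp
  | insert i s hi ih =>
    rw [Finset.prod_insert hi, Finset.sum_insert hi]
    nlinarith [hx i, Finset.sum_nonneg fun j (_ : j ∈ s) => hx j]

variable [DecidableEq ι]

/-- At most one of several independent events is the only one to occur. -/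
lemma prod_add_sum_one_sub_mul_prod_erase_le_one (s : Finset ι) (b : ι → ℝ) (hb0 : ∀ i, 0 ≤ b i)
    (hb1 : ∀ i, b i ≤ 1) :
    ∏ i ∈ s, b i + ∑ i ∈ s, (1 - b i) * ∏ j ∈ s.erase i, b j ≤ 1 := by
  induction s using Finset.induction_on with
  | empty => simp
  | insert i s hi ih =>
    have hsum : ∑ k ∈ s, (1 - b k) * ∏ j ∈ (insert i s).erase k, b j =
        b i * ∑ k ∈ s, (1 - b k) * ∏ j ∈ s.erase k, b j := by
      rw [Finset.mul_sum]
      refine Finset.sum_congr rfl fun k hk => ?_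
      have hik : i ≠ k := fun h => hi (h ▸ hk)
      rw [Finset.erase_insert_of_ne hik,
        Finset.prod_insert fun h => hi (Finset.mem_of_mem_erase h)]
      ring
    rw [Finset.prod_insert hi, Finset.sum_insert hi, Finset.erase_insert hi, hsum]
    have hnonneg : 0 ≤ ∑ k ∈ s, (1 - b k) * ∏ j ∈ s.erase k, b j :=
      Finset.sum_nonneg fun k _ =>
        mul_nonneg (sub_nonneg.2 (hb1 k)) (Finset.prod_nonneg fun j _ => hb0 j)
    nlinarith [mul_le_mul_of_nonneg_right (hb1 i) hnonneg]

/-- Split the agents at the price `p`. A high threshold satisfies `t i * (1 - b i) ≤ p * x i * b i`,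
where `x i` is the odds `1 / a i - 1`, and the odds sum to at most `1 / ∏ a - 1`. So the high agents
earn at most `p * M` times the probability that no low agent exceeds her threshold, the low agents
at most `p * M` times the probability that exactly one does, and these two events are disjoint. -/
lemma sum_solo_le [Fintype ι] {t a b : ι → ℝ} {p : ℝ} (hp : 0 ≤ p)
    (ha0 : ∀ i, 0 < a i) (ha1 : ∀ i, a i ≤ 1) (hb0 : ∀ i, 0 ≤ b i) (hb1 : ∀ i, b i ≤ 1)
    (h : ∀ i, t i ≤ p ∨ t i * (1 - b i) * a i ≤ p * (1 - a i) * b i) :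
    ∑ i, t i * (1 - b i) * ∏ j ∈ Finset.univ.erase i, b j ≤
      p * max 1 ((∏ i, a i)⁻¹ - 1) := by
  set M := max 1 ((∏ i, a i)⁻¹ - 1)
  set L := Finset.univ.filter fun i => t i ≤ p
  set H := Finset.univ.filter fun i => ¬ t i ≤ p
  have hM1 : 1 ≤ M := le_max_left _ _
  have hpr (s : Finset ι) : 0 ≤ ∏ j ∈ s, b j := Finset.prod_nonneg fun j _ => hb0 j
  have hmono {s s' : Finset ι} (hs : s ⊆ s') : ∏ j ∈ s', b j ≤ ∏ j ∈ s, b j := by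
    rw [← Finset.prod_sdiff hs]
    exact mul_le_of_le_one_left (hpr s) (Finset.prod_le_one (fun j _ => hb0 j) fun j _ => hb1 j)
  set x : ι → ℝ := fun i => (a i)⁻¹ - 1
  have hx (i : ι) : 0 ≤ x i := sub_nonneg.2 ((one_le_inv₀ (ha0 i)).2 (ha1 i))
  have hxsum : ∑ i ∈ H, x i ≤ M := by
    have h1 := one_add_sum_le_prod_one_add Finset.univ x hx
    have h2 : ∑ i ∈ H, x i ≤ ∑ i, x i :=
      Finset.sum_le_sum_of_subset_of_nonneg (Finset.subset_univ _) fun i _ _ => hx i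
    have h3 : ∏ i, (1 + x i) = (∏ i, a i)⁻¹ := by
      rw [← Finset.prod_inv_distrib]
      exact Finset.prod_congr rfl fun i _ => by simp only [x]; ring
    have h4 : (∏ i, a i)⁻¹ - 1 ≤ M := le_max_right _ _
    linarith
  have hH : ∑ i ∈ H, t i * (1 - b i) * ∏ j ∈ Finset.univ.erase i, b j ≤
      p * M * ∏ j ∈ L, b j := by
    calc ∑ i ∈ H, t i * (1 - b i) * ∏ j ∈ Finset.univ.erase i, b j
        ≤ ∑ i ∈ H, p * x i * ∏ j ∈ L, b j := by
          refine Finset.sum_le_sum fun i hi => ?_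
          have hi' := (h i).resolve_left (Finset.mem_filter.1 hi).2
          have h1 : t i * (1 - b i) ≤ p * x i * b i := by
            have h2 : p * x i * b i = p * (1 - a i) * b i / a i := by
              have := (ha0 i).ne'
              simp only [x]
              field_simp
            rw [h2, le_div_iff₀ (ha0 i)]
            exact hi'
          calc t i * (1 - b i) * ∏ j ∈ Finset.univ.erase i, b j
              ≤ p * x i * b i * ∏ j ∈ Finset.univ.erase i, b j :=
                mul_le_mul_of_nonneg_right h1 (hpr _)
            _ = p * x i * ∏ j, b j := by
                rw [mul_assoc, Finset.mul_prod_erase _ _ (Finset.mem_univ i)]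
            _ ≤ p * x i * ∏ j ∈ L, b j :=
                mul_le_mul_of_nonneg_left (hmono (Finset.subset_univ _)) (mul_nonneg hp (hx i))
      _ = p * (∑ i ∈ H, x i) * ∏ j ∈ L, b j := by rw [← Finset.sum_mul, ← Finset.mul_sum]
      _ ≤ _ := mul_le_mul_of_nonneg_right (mul_le_mul_of_nonneg_left hxsum hp) (hpr L)
  have hL : ∑ i ∈ L, t i * (1 - b i) * ∏ j ∈ Finset.univ.erase i, b j ≤
      p * M * ∑ i ∈ L, (1 - b i) * ∏ j ∈ L.erase i, b j := by
    rw [Finset.mul_sum]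
    refine Finset.sum_le_sum fun i hi => ?_
    have hb := sub_nonneg.2 (hb1 i)
    calc t i * (1 - b i) * ∏ j ∈ Finset.univ.erase i, b j
        ≤ p * (1 - b i) * ∏ j ∈ L.erase i, b j :=
          mul_le_mul (mul_le_mul_of_nonneg_right (Finset.mem_filter.1 hi).2 hb)
            (hmono (Finset.erase_subset_erase _ (Finset.subset_univ _))) (hpr _)
            (mul_nonneg hp hb)
      _ = p * ((1 - b i) * ∏ j ∈ L.erase i, b j) := by ring
      _ ≤ p * M * ((1 - b i) * ∏ j ∈ L.erase i, b j) :=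
          mul_le_mul_of_nonneg_right (le_mul_of_one_le_right hp hM1) (mul_nonneg hb (hpr _))
  have hone := mul_le_mul_of_nonneg_left
    (prod_add_sum_one_sub_mul_prod_erase_le_one L b hb0 hb1) (mul_nonneg hp (zero_le_one.trans hM1))
  rw [← Finset.sum_filter_add_sum_filter_not Finset.univ fun i => t i ≤ p]
  linarith

lemma soloRev_le {𝓕 : Fin n → Measure ℝ} [∀ i, IsProbabilityMeasure (𝓕 i)]
    (h0 : ∀ i, 𝓕 i (Set.Iio 0) = 0) (hreg : ∀ i, IsRegular (𝓕 i)) {p : ℝ} (hp : 0 ≤ p)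
    (hpos : 0 < ∏ i, cdf (𝓕 i) p) (T : Fin n → ℝ≥0∞) :
    soloRev 𝓕 T Finset.univ ≤
      ENNReal.ofReal (p * max 1 ((∏ i, cdf (𝓕 i) p)⁻¹ - 1)) := by
  set t : Fin n → ℝ := fun i => (T i).toReal
  set b : Fin n → ℝ := fun i => (F (𝓕 i) (T i)).toReal
  have hFb (i : Fin n) : F (𝓕 i) (T i) = ENNReal.ofReal (b i) :=
    (ENNReal.ofReal_toReal (F_ne_top _ _)).symm
  have hb0 (i : Fin n) : 0 ≤ b i := ENNReal.toReal_nonneg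
  have hb1 (i : Fin n) : b i ≤ 1 := by
    simpa using ENNReal.toReal_mono ENNReal.one_ne_top (F_le_one (𝓕 i) (T i))
  have hterm (i : Fin n) : T i * (1 - F (𝓕 i) (T i)) * ∏ j ∈ Finset.univ.erase i, F (𝓕 j) (T j) =
      ENNReal.ofReal (t i * (1 - b i) * ∏ j ∈ Finset.univ.erase i, b j) := by
    have hsub : 1 - F (𝓕 i) (T i) = ENNReal.ofReal (1 - b i) := by
      rw [ENNReal.ofReal_sub _ (hb0 i), ENNReal.ofReal_one, ← hFb]
    rw [ENNReal.ofReal_mul (mul_nonneg ENNReal.toReal_nonneg (sub_nonneg.2 (hb1 i))),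
      ENNReal.ofReal_prod_of_nonneg fun j _ => hb0 j, Finset.prod_congr rfl fun j _ => hFb j]
    congr 1
    rcases eq_or_ne (T i) ∞ with h | h
    · have hbi : b i = 1 := by simp [b, h, F_top]
      rw [hsub, hbi]
      simp
    · rw [ENNReal.ofReal_mul ENNReal.toReal_nonneg, ENNReal.ofReal_toReal h, hsub]
  have hap (i : Fin n) : 0 < cdf (𝓕 i) p :=
    (cdf_nonneg _ _).lt_of_ne' fun h => hpos.ne' (Finset.prod_eq_zero (Finset.mem_univ i) h)
  rw [soloRev, Finset.sum_congr rfl fun i _ => hterm i, ← ENNReal.ofReal_sum_of_nonneg]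
  · refine ENNReal.ofReal_le_ofReal (sum_solo_le hp hap (fun i => cdf_le_one _ _) hb0 hb1 ?_)
    intro i
    rcases le_total (t i) p with h | h
    · exact Or.inl h
    rcases eq_or_ne (T i) ∞ with hT | hT
    -- An infinite threshold becomes `t i = 0`. This loses nothing, since the agent then never buys
    -- and her term vanishes.
    · exact Or.inl (by simpa [t, hT] using hp)
    right
    have hbi : b i = cdf (𝓕 i) (t i) := by
      simp only [b, t]
      lift T i to ℝ≥0 using hT with y
      rw [F_coe, ENNReal.toReal_ofReal (cdf_nonneg _ _), ENNReal.coe_toReal]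
    rw [hbi]
    exact (hreg i).mul_survival_mul_cdf_le (h0 i) hp h
  · intro i _
    exact mul_nonneg (mul_nonneg ENNReal.toReal_nonneg (sub_nonneg.2 (hb1 i)))
      (Finset.prod_nonneg fun j _ => hb0 j)

lemma simOpt_le {𝓕 : Fin n → Measure ℝ} [∀ i, IsProbabilityMeasure (𝓕 i)] {B : ℝ≥0∞}
    (hB : ∀ T, soloRev 𝓕 T Finset.univ ≤ B) : simOpt fullExt 𝓕 ≤ B :=
  iSup_le fun _ => iSup₂_le fun T hT => (simRev_eq_soloRev hT).trans_le (hB T)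

lemma seqOpt_le {𝓕 : Fin n → Measure ℝ} [∀ i, IsProbabilityMeasure (𝓕 i)] {B : ℝ≥0∞}
    (hB : ∀ T, soloRev 𝓕 T Finset.univ ≤ B) (σ : Equiv.Perm (Fin n)) : seqOpt fullExt 𝓕 σ ≤ B :=
  iSup_le fun p => by
    obtain ⟨T, hT⟩ := exists_seqRev_eq_soloRev (𝓕 := 𝓕) σ p
    exact hT.trans_le (hB T)

/-- Half of a price at which a private good is sold with moderate probability guarantees a
`4 e`-approximation of the bound on the benchmarks. -/
lemma benchmark_div_le {𝓕 : Fin n → Measure ℝ} [∀ i, IsProbabilityMeasure (𝓕 i)] {p : ℝ≥0}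
    (hlo : 3 / 10 < ∏ i, cdf (𝓕 i) p) (hhi : ∏ i, cdf (𝓕 i) p < 4 / 5) :
    ENNReal.ofReal (p * max 1 ((∏ i, cdf (𝓕 i) p)⁻¹ - 1)) / ENNReal.ofReal (4 * Real.exp 1) ≤
      ((p / 2 : ℝ≥0) : ℝ≥0∞) *
        min (1 / 2) (1 - ∏ i, F (𝓕 i) (2 * ((p / 2 : ℝ≥0) : ℝ≥0∞))) := by
  have h2 : (2 : ℝ≥0∞) * ((p / 2 : ℝ≥0) : ℝ≥0∞) = p := by
    rw [ENNReal.coe_div two_ne_zero]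
    exact ENNReal.mul_div_cancel two_ne_zero ENNReal.ofNat_ne_top
  rw [h2, Finset.prod_congr rfl fun i _ => F_coe (𝓕 i) p,
    ← ENNReal.ofReal_prod_of_nonneg fun i _ => cdf_nonneg _ _]
  set q := ∏ i, cdf (𝓕 i) (p : ℝ)
  have hq0 : 0 < q := by linarith
  have hmin : min (1 / 2) (1 - ENNReal.ofReal q) = ENNReal.ofReal (min (1 / 2) (1 - q)) := by
    rw [ENNReal.ofReal_min, ENNReal.ofReal_sub _ hq0.le, ENNReal.ofReal_one,
      ENNReal.ofReal_div_of_pos two_pos]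
    simp
  have he : 0 < 4 * Real.exp 1 := by positivity
  rw [hmin, ← ENNReal.ofReal_coe_nnreal, ← ENNReal.ofReal_mul (NNReal.coe_nonneg _),
    ← ENNReal.ofReal_div_of_pos he]
  refine ENNReal.ofReal_le_ofReal ?_
  rw [div_le_iff₀ he, NNReal.coe_div, NNReal.coe_two]
  have hexp : (2.7 : ℝ) < Real.exp 1 := by linarith [Real.exp_one_gt_d9]
  -- For `q ≤ 1/2` the worst case is `10/3 - 1 < e`; for `q ≥ 1/2` it is `1 < 2 e (1 - 4/5)`, while
  -- `1 / q - 1 ≤ 2 (1 - q)`.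
  have hmain : max 1 (q⁻¹ - 1) ≤ 2 * Real.exp 1 * min (1 / 2) (1 - q) := by
    have hinv : q⁻¹ * q = 1 := inv_mul_cancel₀ hq0.ne'
    have hinv0 : 0 < q⁻¹ := inv_pos.2 hq0
    rcases le_total (1 / 2) (1 - q) with h | h
    · rw [min_eq_left h]
      refine max_le (by linarith) ?_
      nlinarith
    · rw [min_eq_right h]
      refine max_le (by nlinarith) ?_
      nlinarith
  calc (p : ℝ) * max 1 (q⁻¹ - 1) ≤ p * (2 * Real.exp 1 * min (1 / 2) (1 - q)) :=
        mul_le_mul_of_nonneg_left hmain (NNReal.coe_nonneg p)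
    _ = _ := by ring

end UpperBound

/-! ## Existence of equilibria

Equilibria are found by minimising a potential function on a compact box. -/

section Existence

open Filter Topology

/-- The probability that the value `v` satisfies `v * u ≤ c`. -/
def rejectProb (μ : Measure ℝ) (c u : ℝ) : ℝ := if u ≤ 0 then 1 else cdf μ (c / u)

variable {μ : Measure ℝ} {c : ℝ}

lemma rejectProb_zero : rejectProb μ c 0 = 1 := if_pos le_rfl

lemma rejectProb_nonneg (u : ℝ) : 0 ≤ rejectProb μ c u := by
  rw [rejectProb]
  split_ifs
  exacts [zero_le_one, cdf_nonneg _ _]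

lemma rejectProb_le_one (u : ℝ) : rejectProb μ c u ≤ 1 := by
  rw [rejectProb]
  split_ifs
  exacts [le_rfl, cdf_le_one _ _]

lemma antitone_rejectProb (hc : 0 < c) : Antitone (rejectProb μ c) := by
  intro u w huw
  rcases le_or_gt u 0 with hu | hu
  · rw [rejectProb, rejectProb, if_pos hu]
    split_ifs
    exacts [le_rfl, cdf_le_one _ _]
  · rw [rejectProb, rejectProb, if_neg hu.not_ge, if_neg (hu.trans_le huw).not_ge]
    exact monotone_cdf μ (div_le_div_of_nonneg_left hc.le hu huw)

lemma continuous_rejectProb (hc : 0 < c) (hμ : Continuous (cdf μ)) :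
    Continuous (rejectProb μ c) := by
  refine continuous_iff_continuousAt.2 fun u => ?_
  rcases lt_trichotomy u 0 with hu | rfl | hu
  · refine (continuousAt_const (y := (1 : ℝ))).congr ?_
    filter_upwards [gt_mem_nhds hu] with w hw
    rw [rejectProb, if_pos (le_of_lt hw)]
  -- As `u` decreases to 0 the threshold `c / u` tends to infinity, so the distribution function
  -- tends to 1.
  · rw [ContinuousAt, rejectProb_zero]
    refine tendsto_order.2 ⟨fun a ha => ?_, fun a ha =>
      Eventually.of_forall fun w => (rejectProb_le_one w).trans_lt ha⟩
    obtain ⟨m, hm, hm0⟩ := (((tendsto_cdf_atTop μ).eventually (lt_mem_nhds ha)).and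
      (eventually_gt_atTop 0)).exists
    filter_upwards [gt_mem_nhds (div_pos hc hm0)] with w hw
    rw [rejectProb]
    split_ifs with h
    · exact ha
    · refine hm.trans_le (monotone_cdf μ ?_)
      have hw' : w < c / m := hw
      rw [le_div_iff₀ (not_le.1 h)]
      rw [lt_div_iff₀ hm0] at hw'
      linarith
  · have : ContinuousAt (fun w => cdf μ (c / w)) u :=
      hμ.continuousAt.comp (continuousAt_const.div continuousAt_id hu.ne')
    refine this.congr ?_
    filter_upwards [lt_mem_nhds hu] with w hw
    rw [rejectProb, if_neg (not_le.2 hw)]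

/-- For antitone `G` the reverse inequality always holds, strictly unless `G` is constant between
`u` and `a`. -/
lemma eq_of_mul_le_integral {G : ℝ → ℝ} (hG : Continuous G) (hanti : Antitone G) {u a : ℝ}
    (h : (a - u) * G u ≤ ∫ s in u..a, G s) : G a = G u := by
  by_contra hne
  rcases lt_trichotomy u a with hua | rfl | hua
  · have hlt := intervalIntegral.integral_lt_integral_of_continuousOn_of_le_of_exists_lt hua
      hG.continuousOn (continuousOn_const (c := G u)) (fun s hs => hanti hs.1.le)
      ⟨a, Set.right_mem_Icc.2 hua.le, (hanti hua.le).lt_of_ne hne⟩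
    rw [intervalIntegral.integral_const, smul_eq_mul] at hlt
    linarith
  · exact hne rfl
  · have hlt := intervalIntegral.integral_lt_integral_of_continuousOn_of_le_of_exists_lt hua
      (continuousOn_const (c := G u)) hG.continuousOn (fun s hs => hanti hs.2)
      ⟨a, Set.left_mem_Icc.2 hua.le, (hanti hua.le).lt_of_ne' hne⟩
    rw [intervalIntegral.integral_const, smul_eq_mul] at hlt
    rw [intervalIntegral.integral_symm] at h
    linarith

/-- Formally `∂Φ/∂u_i = (a_i - u_i) G_i'(u_i)` with `a_i = ∏_{j ≠ i} G_j(u_j)`. As `G_i` is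
antitone, moving `u_i` to `a_i` can only lower `Φ`, so at a minimiser `G_i` cannot distinguish the
two points. -/
lemma exists_balanced {ι : Type*} [Fintype ι] [DecidableEq ι] (G : ι → ℝ → ℝ)
    (hG : ∀ i, Continuous (G i)) (hanti : ∀ i, Antitone (G i)) (h0 : ∀ i u, 0 ≤ G i u)
    (h1 : ∀ i u, G i u ≤ 1) :
    ∃ u : ι → ℝ, ∀ i, G i (∏ j ∈ Finset.univ.erase i, G j (u j)) = G i (u i) := by
  -- `K i` plays the role of `∫ s dG_i(s)`, integrated by parts so that no derivative of `G_i` is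
  -- needed.
  set K : ι → ℝ → ℝ := fun i u => u * G i u - ∫ s in (0 : ℝ)..u, G i s with hK
  set Φ : (ι → ℝ) → ℝ := fun u => ∏ i, G i (u i) - ∑ i, K i (u i) with hΦ
  have hKc (i : ι) : Continuous (K i) :=
    (continuous_id.mul (hG i)).sub (intervalIntegral.continuous_primitive
      (fun a b => (hG i).intervalIntegrable a b) 0)
  have hΦc : Continuous Φ :=
    (continuous_finsetProd _ fun i _ => (hG i).comp (continuous_apply i)).sub
      (continuous_finsetSum _ fun i _ => (hKc i).comp (continuous_apply i))
  obtain ⟨u, hu, hmin⟩ := (isCompact_Icc (a := (0 : ι → ℝ)) (b := 1)).exists_isMinOn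
    (Set.nonempty_Icc.2 zero_le_one) hΦc.continuousOn
  refine ⟨u, fun i => ?_⟩
  set a := ∏ j ∈ Finset.univ.erase i, G j (u j) with ha
  have ha0 : 0 ≤ a := Finset.prod_nonneg fun j _ => h0 _ _
  have ha1 : a ≤ 1 := Finset.prod_le_one (fun j _ => h0 _ _) fun j _ => h1 _ _
  set w := Function.update u i a with hw
  have hwmem : w ∈ Set.Icc (0 : ι → ℝ) 1 :=
    ⟨le_update_iff.2 ⟨ha0, fun j _ => hu.1 j⟩, update_le_iff.2 ⟨ha1, fun j _ => hu.2 j⟩⟩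
  have hle : Φ u ≤ Φ w := hmin hwmem
  have hwj {j : ι} (hj : j ∈ Finset.univ.erase i) : w j = u j :=
    Function.update_of_ne (Finset.ne_of_mem_erase hj) _ _
  have hwi : w i = a := Function.update_self ..
  have hprodw : ∏ j ∈ Finset.univ.erase i, G j (w j) = a :=
    Finset.prod_congr rfl fun j hj => by rw [hwj hj]
  have hsumw : ∑ j ∈ Finset.univ.erase i, K j (w j) = ∑ j ∈ Finset.univ.erase i, K j (u j) :=
    Finset.sum_congr rfl fun j hj => by rw [hwj hj]
  simp only [hΦ] at hle
  rw [← Finset.mul_prod_erase _ _ (Finset.mem_univ i),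
    ← Finset.add_sum_erase _ (fun j => K j (u j)) (Finset.mem_univ i),
    ← Finset.mul_prod_erase _ (fun j => G j (w j)) (Finset.mem_univ i),
    ← Finset.add_sum_erase _ (fun j => K j (w j)) (Finset.mem_univ i), hprodw, hsumw, hwi,
    ← ha] at hle
  simp only [hK] at hle
  refine eq_of_mul_le_integral (hG i) (hanti i) ?_
  have hint := intervalIntegral.integral_interval_sub_left
    ((hG i).intervalIntegrable 0 a) ((hG i).intervalIntegrable 0 (u i)) (μ := volume)
  linarith

variable {𝓕 : Fin n → Measure ℝ} [∀ i, IsProbabilityMeasure (𝓕 i)]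

lemma F_threshold_eq_rejectProb (μ : Measure ℝ) [IsProbabilityMeasure μ] (c : ℝ≥0)
    {a : ℝ} (ha0 : 0 ≤ a) (ha1 : a ≤ 1) :
    F μ (threshold c (1 - ENNReal.ofReal a)) = ENNReal.ofReal (rejectProb μ c a) := by
  rw [threshold_one_sub (ENNReal.ofReal_le_one.2 ha1)]
  rcases ha0.eq_or_lt with rfl | h
  · simp [F_top, rejectProb_zero]
  · lift a to ℝ≥0 using ha0
    have ha : a ≠ 0 := by exact_mod_cast h.ne'
    rw [if_neg (ENNReal.ofReal_pos.2 h).ne', rejectProb, if_neg h.not_ge,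
      ENNReal.ofReal_coe_nnreal, ← ENNReal.coe_div ha, F_coe, NNReal.coe_div]

/-- At price 0 let a single agent buy surely. Everyone else then has denominator 0, hence threshold
`∞`. -/
lemma simEq_zero_nonempty (h0 : ∀ i, F (𝓕 i) 0 = 0) :
    (simEq fullExt 𝓕 fun _ => 0).Nonempty := by
  rcases isEmpty_or_nonempty (Fin n) with h | ⟨⟨k⟩⟩
  · exact ⟨fun _ => 0, mem_simEq_fullExt.2 fun i => isEmptyElim i⟩
  refine ⟨fun i => if i = k then 0 else ∞, mem_simEq_fullExt.2 fun i => ?_⟩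
  by_cases hi : i = k
  · subst hi
    rw [Finset.prod_eq_one fun j hj => by rw [if_neg (Finset.ne_of_mem_erase hj), F_top]]
    simp [threshold]
  · rw [if_neg hi, Finset.prod_eq_zero (Finset.mem_erase.2 ⟨Ne.symm hi, Finset.mem_univ k⟩)
      (by rw [if_pos rfl, h0])]
    simp [threshold]

lemma simEq_nonempty (h0 : ∀ i, 𝓕 i (Set.Iio 0) = 0) (ha : ∀ i v, 𝓕 i {v} = 0) (c : ℝ≥0) :
    (simEq fullExt 𝓕 fun _ => (c : ℝ≥0∞)).Nonempty := by
  rcases eq_or_ne c 0 with rfl | hc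
  · refine simEq_zero_nonempty fun i => ?_
    have := F_coe (𝓕 i) 0
    rw [NNReal.coe_zero, cdf_zero (h0 i) (ha i)] at this
    simpa using this
  have hc' : (0 : ℝ) < c := by exact_mod_cast pos_iff_ne_zero.2 hc
  obtain ⟨u, hu⟩ := exists_balanced (fun i => rejectProb (𝓕 i) c)
    (fun i => continuous_rejectProb hc' (continuous_cdf (ha i)))
    (fun i => antitone_rejectProb hc') (fun _ => rejectProb_nonneg) fun _ => rejectProb_le_one
  set a : Fin n → ℝ := fun i => ∏ j ∈ Finset.univ.erase i, rejectProb (𝓕 j) c (u j) with hadef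
  have ha0 (i : Fin n) : 0 ≤ a i := Finset.prod_nonneg fun j _ => rejectProb_nonneg _
  have ha1 (i : Fin n) : a i ≤ 1 :=
    Finset.prod_le_one (fun j _ => rejectProb_nonneg _) fun j _ => rejectProb_le_one _
  -- The thresholds are computed from `a`, not from `u`: the two may differ, but the rejection
  -- probabilities agree.
  refine ⟨fun i => threshold c (1 - ENNReal.ofReal (a i)), mem_simEq_fullExt.2 fun i => ?_⟩
  have : ∏ j ∈ Finset.univ.erase i, F (𝓕 j) (threshold c (1 - ENNReal.ofReal (a j))) =
      ENNReal.ofReal (a i) := by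
    rw [hadef, ENNReal.ofReal_prod_of_nonneg fun j _ => rejectProb_nonneg _]
    refine Finset.prod_congr rfl fun j _ => ?_
    rw [F_threshold_eq_rejectProb _ c (ha0 j) (ha1 j), hu j]
  rw [this]

end Existence

/-! ## Searching a grid of quantiles for an approximate median of the maximum -/

section Grid

lemma prod_le_prod_add_card_mul {ι : Type*} (s : Finset ι) {a b : ι → ℝ} {δ : ℝ}
    (ha0 : ∀ i, 0 ≤ a i) (hb0 : ∀ i, 0 ≤ b i) (ha1 : ∀ i, a i ≤ 1) (hb1 : ∀ i, b i ≤ 1)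
    (hδ : 0 ≤ δ) (h : ∀ i, b i ≤ a i + δ) :
    ∏ i ∈ s, b i ≤ ∏ i ∈ s, a i + s.card * δ := by
  classical
  induction s using Finset.induction_on with
  | empty => simp
  | insert i s hi ih =>
    rw [Finset.prod_insert hi, Finset.prod_insert hi, Finset.card_insert_of_notMem hi]
    have hA1 : ∏ j ∈ s, a j ≤ 1 := Finset.prod_le_one (fun j _ => ha0 j) fun j _ => ha1 j
    have hA0 : 0 ≤ ∏ j ∈ s, a j := Finset.prod_nonneg fun j _ => ha0 j
    have hc : (0 : ℝ) ≤ s.card * δ := by positivity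
    push_cast
    calc b i * ∏ j ∈ s, b j ≤ b i * (∏ j ∈ s, a j + s.card * δ) :=
          mul_le_mul_of_nonneg_left ih (hb0 i)
      _ ≤ (a i + δ) * ∏ j ∈ s, a j + 1 * (s.card * δ) := by
          rw [mul_add]
          exact add_le_add (mul_le_mul_of_nonneg_right (h i) hA0)
            (mul_le_mul_of_nonneg_right (hb1 i) hc)
      _ ≤ _ := by nlinarith

variable {𝓕 : Fin n → Measure ℝ} [∀ i, IsProbabilityMeasure (𝓕 i)]

lemma exists_quantile_prod_cdf_mem (hn : 0 < n) (hc : ∀ i, Continuous (cdf (𝓕 i)))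
    (h0 : ∀ i, cdf (𝓕 i) 0 = 0) :
    ∃ (i : Fin n) (k : ℕ), 0 < k ∧ k < 4 * n ∧
      1 / 2 ≤ ∏ j, cdf (𝓕 j) (quantile (𝓕 i) (k / (4 * n))) ∧
      ∏ j, cdf (𝓕 j) (quantile (𝓕 i) (k / (4 * n))) ≤ 3 / 4 := by
  have hN : (0 : ℝ) < 4 * n := by positivity
  set P : ℝ → ℝ := fun x => ∏ j, cdf (𝓕 j) x
  have hPc : Continuous P := continuous_finsetProd _ fun j _ => hc j
  have hP0 : P 0 = 0 := Finset.prod_eq_zero (Finset.mem_univ ⟨0, hn⟩) (h0 _)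
  have hP1 : Filter.Tendsto P Filter.atTop (nhds 1) := by
    simpa using tendsto_finsetProd Finset.univ fun j (_ : j ∈ Finset.univ) =>
      tendsto_cdf_atTop (𝓕 j)
  obtain ⟨b, hb, hb0⟩ := ((hP1.eventually (lt_mem_nhds (show (1 / 2 : ℝ) < 1 by norm_num))).and
    (Filter.eventually_ge_atTop 0)).exists
  obtain ⟨m, -, hm⟩ := intermediate_value_Icc hb0 hPc.continuousOn
    (show (1 / 2 : ℝ) ∈ Set.Icc (P 0) (P b) from ⟨by rw [hP0]; norm_num, le_of_lt hb⟩)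
  -- With `m` a median of the maximum, `κ j / (4n)` is the first grid level strictly above `F_j(m)`.
  set κ : Fin n → ℕ := fun j => ⌊4 * n * cdf (𝓕 j) m⌋₊ + 1
  have hκ1 (j : Fin n) : cdf (𝓕 j) m < κ j / (4 * n) := by
    rw [lt_div_iff₀ hN, mul_comm]
    simpa [κ] using Nat.lt_floor_add_one (4 * (n : ℝ) * cdf (𝓕 j) m)
  have hκ2 (j : Fin n) : (κ j : ℝ) / (4 * n) ≤ cdf (𝓕 j) m + 1 / (4 * n) := by
    rw [div_le_iff₀ hN, add_mul, div_mul_cancel₀ _ hN.ne']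
    have := Nat.floor_le (mul_nonneg hN.le (cdf_nonneg (𝓕 j) m))
    simp only [κ]
    push_cast
    linarith
  -- Raising each of `n` factors by at most `1 / (4n)` raises the product from 1/2 to at most 3/4.
  have hbound {x : ℝ} (hx : ∀ j, cdf (𝓕 j) x ≤ cdf (𝓕 j) m + 1 / (4 * n)) : P x ≤ 3 / 4 := by
    have := prod_le_prod_add_card_mul Finset.univ (fun j => cdf_nonneg (𝓕 j) m)
      (fun j => cdf_nonneg (𝓕 j) x) (fun j => cdf_le_one _ _) (fun j => cdf_le_one _ _)
      (by positivity) hx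
    have hcard : (Finset.univ : Finset (Fin n)).card * (1 / (4 * (n : ℝ))) = 1 / 4 := by
      have : (n : ℝ) ≠ 0 := by positivity
      rw [Finset.card_univ, Fintype.card_fin]
      field_simp
    rw [hcard] at this
    have h2 : ∏ j, cdf (𝓕 j) m = 1 / 2 := hm
    rw [h2] at this
    simp only [P]
    linarith
  -- Only these agents have a usable level below 1; the others satisfy the bound at every price. The
  -- smallest of their quantiles is above `m` yet overshoots nobody's level.
  set K := Finset.univ.filter fun j => κ j < 4 * n
  have hnotK {j : Fin n} (hj : j ∉ K) (x : ℝ) : cdf (𝓕 j) x ≤ cdf (𝓕 j) m + 1 / (4 * n) := by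
    have h4 : 4 * n ≤ κ j := by simpa [K] using hj
    have h4' : (1 : ℝ) ≤ κ j / (4 * n) := by
      rw [one_le_div hN]
      exact_mod_cast h4
    exact (cdf_le_one _ _).trans (h4'.trans (hκ2 j))
  have hK : K.Nonempty := by
    by_contra hK
    rw [Finset.not_nonempty_iff_eq_empty] at hK
    have : (1 : ℝ) ≤ 3 / 4 :=
      le_of_tendsto hP1 (Filter.Eventually.of_forall fun x => hbound fun j =>
        hnotK (by rw [hK]; exact Finset.notMem_empty j) x)
    norm_num at this
  obtain ⟨i, hi, hmin⟩ := K.exists_min_image (fun j => quantile (𝓕 j) (κ j / (4 * n))) hK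
  have hquant {j : Fin n} (hj : j ∈ K) :
      cdf (𝓕 j) (quantile (𝓕 j) (κ j / (4 * n))) = κ j / (4 * n) := by
    refine cdf_quantile (hc j) ⟨by positivity, ?_⟩
    rw [div_lt_one hN]
    exact_mod_cast (Finset.mem_filter.1 hj).2
  set x := quantile (𝓕 i) (κ i / (4 * n)) with hx
  have hmx : m ≤ x := by
    by_contra h
    have := monotone_cdf (𝓕 i) (not_le.1 h).le
    rw [hx, hquant hi] at this
    exact absurd (hκ1 i) (not_lt.2 this)
  refine ⟨i, κ i, Nat.succ_pos _, (Finset.mem_filter.1 hi).2, ?_, hbound fun j => ?_⟩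
  · rw [← hm]
    exact Finset.prod_le_prod (fun j _ => cdf_nonneg _ _) fun j _ => monotone_cdf _ hmx
  · by_cases hj : j ∈ K
    · exact ((monotone_cdf (𝓕 j) (hmin j hj)).trans_eq (hquant hj)).trans (hκ2 j)
    · exact hnotK hj x

end Grid

/-! ## The program -/

section Machine

/-- Searches the quantiles `F_i⁻¹(k / (4 n))` for a price at which the item remains unsold with
probability between `3/10` and `4/5`, and returns half of it. -/
def medianSearch : Program :=
  -- `4n` is built by repeated addition, as natural registers cannot be read as reals. `natJumpLe 0
  -- 0 t` is an unconditional jump.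
  [.const 6 4,
   .natJumpLe 0 1 5,
   .add 1 1 6,
   .natSucc 1,
   .natJumpLe 0 0 1,
   .const 6 1,
   .div 1 6 1,
   .const 7 (3 / 10),
   .const 8 (4 / 5),
   -- `N[2]` is the agent, `R[2]` the grid level, `R[0]` the candidate, `R[4]` the running product.
   -- Target 28 is the program's length, so jumping there halts.
   .natJumpLe 0 2 28,
   .const 2 0,
   .add 2 2 1,
   .jumpLe 6 2 26,
   .evalQuantile 0 2 2,
   .const 4 1,
   .natZero 3,
   .natJumpLe 0 3 21,
   .evalCdf 5 3 0,
   .mul 4 4 5,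
   .natSucc 3,
   .natJumpLe 0 0 16,
   .jumpLe 4 7 11,
   .jumpLe 8 4 11,
   .const 4 (1 / 2),
   .mul 0 0 4,
   .natJumpLe 0 0 28,
   .natSucc 2,
   .natJumpLe 0 0 9]

/-- From the configuration `s`, the program halts after at most `r` steps with an output that
satisfies `Q`. -/
def Program.HaltsWithin (P : Program) (𝓕 : Fin n → Measure ℝ) (Q : ℝ → Prop) (s : Config)
    (r : ℕ) : Prop :=
  ∃ m ≤ r, P.length ≤ ((P.step 𝓕)^[m] s).pc ∧ Q (((P.step 𝓕)^[m] s).real 0)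

variable {𝓕 : Fin n → Measure ℝ} {Q : ℝ → Prop} {s s' : Config} {r r' : ℕ}
  {N : ℕ → ℕ} {R : ℕ → ℝ}

lemma Program.HaltsWithin.mono {P : Program} (h : P.HaltsWithin 𝓕 Q s r) (hr : r ≤ r') :
    P.HaltsWithin 𝓕 Q s r' :=
  let ⟨m, hm, h⟩ := h
  ⟨m, hm.trans hr, h⟩

/-- Verification runs in continuation style: halting from a later configuration is assumed, and
loops are inductions on the iterations left. -/
lemma Program.HaltsWithin.step {P : Program} (hs : P.step 𝓕 s = s') (h : P.HaltsWithin 𝓕 Q s' r) :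
    P.HaltsWithin 𝓕 Q s (r + 1) := by
  obtain ⟨m, hm, h⟩ := h
  refine ⟨m + 1, Nat.succ_le_succ hm, ?_⟩
  rwa [Function.iterate_succ_apply, hs]

lemma Program.HaltsWithin.natJump {P : Program} {pc a b t : ℕ}
    (hP : P[pc]? = some (.natJumpLe a b t)) (hab : N a ≤ N b)
    (h : P.HaltsWithin 𝓕 Q ⟨t, N, R⟩ r) : P.HaltsWithin 𝓕 Q ⟨pc, N, R⟩ (r + 1) :=
  h.step (by simp only [Program.step, hP, Instr.exec, if_pos hab])

lemma Program.HaltsWithin.natSkip {P : Program} {pc a b t : ℕ}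
    (hP : P[pc]? = some (.natJumpLe a b t)) (hab : ¬ N a ≤ N b)
    (h : P.HaltsWithin 𝓕 Q ⟨pc + 1, N, R⟩ r) : P.HaltsWithin 𝓕 Q ⟨pc, N, R⟩ (r + 1) :=
  h.step (by simp only [Program.step, hP, Instr.exec, if_neg hab])

lemma Program.HaltsWithin.realJump {P : Program} {pc a b t : ℕ}
    (hP : P[pc]? = some (.jumpLe a b t)) (hab : R a ≤ R b)
    (h : P.HaltsWithin 𝓕 Q ⟨t, N, R⟩ r) : P.HaltsWithin 𝓕 Q ⟨pc, N, R⟩ (r + 1) :=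
  h.step (by simp only [Program.step, hP, Instr.exec, if_pos hab])

lemma Program.HaltsWithin.realSkip {P : Program} {pc a b t : ℕ}
    (hP : P[pc]? = some (.jumpLe a b t)) (hab : ¬ R a ≤ R b)
    (h : P.HaltsWithin 𝓕 Q ⟨pc + 1, N, R⟩ r) : P.HaltsWithin 𝓕 Q ⟨pc, N, R⟩ (r + 1) :=
  h.step (by simp only [Program.step, hP, Instr.exec, if_neg hab])

/-- The registers that `medianSearch` does not change during its search hold their constants. -/
structure SearchConstants (n : ℕ) (N : ℕ → ℕ) (R : ℕ → ℝ) : Prop where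
  agents : N 0 = n
  mesh : R 1 = 1 / (4 * n)
  one : R 6 = 1
  lower : R 7 = 3 / 10
  upper : R 8 = 4 / 5

lemma SearchConstants.updateReal (h : SearchConstants n N R) {a : ℕ} {v : ℝ}
    (ha : a ≠ 1 ∧ a ≠ 6 ∧ a ≠ 7 ∧ a ≠ 8) : SearchConstants n N (Function.update R a v) := by
  obtain ⟨h1, h2, h3, h4⟩ := ha
  refine ⟨h.agents, ?_, ?_, ?_, ?_⟩
  · rw [Function.update_of_ne h1.symm, h.mesh]
  · rw [Function.update_of_ne h2.symm, h.one]
  · rw [Function.update_of_ne h3.symm, h.lower]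
  · rw [Function.update_of_ne h4.symm, h.upper]

lemma SearchConstants.updateNat (h : SearchConstants n N R) {a m : ℕ} (ha : a ≠ 0) :
    SearchConstants n (Function.update N a m) R :=
  ⟨by rw [Function.update_of_ne ha.symm, h.agents], h.mesh, h.one, h.lower, h.upper⟩

/-- The probability that a private good remains unsold at the price `x`, in terms of the answers
of the oracle. -/
def oracleUnsold (𝓕 : Fin n → Measure ℝ) (m : ℕ) (x : ℝ) : ℝ :=
  ∏ j ∈ Finset.range m, oracleCdf 𝓕 j x

lemma oracleUnsold_eq (x : ℝ) : oracleUnsold 𝓕 n x = ∏ j, cdf (𝓕 j) x := by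
  rw [oracleUnsold, Finset.prod_range]
  exact Finset.prod_congr rfl fun j _ => by simp [oracleCdf]

/-- The inner loop multiplies the answers of the oracle. -/
lemma haltsWithin_unsold_loop {i : ℕ} {x q : ℝ}
    (hcont : ∀ N R, SearchConstants n N R → N 2 = i → R 0 = x → R 2 = q →
      R 4 = oracleUnsold 𝓕 n x → medianSearch.HaltsWithin 𝓕 Q ⟨21, N, R⟩ r)
    (d : ℕ) : ∀ N R, SearchConstants n N R → N 2 = i → R 0 = x → R 2 = q → N 3 + d = n →
      R 4 = oracleUnsold 𝓕 (N 3) x →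
      medianSearch.HaltsWithin 𝓕 Q ⟨16, N, R⟩ (r + 5 * d + 1) := by
  induction d with
  | zero =>
    intro N R hC h2 hx hq h3 h4
    rw [add_zero] at h3
    refine .natJump rfl (by rw [hC.agents, h3]) (hcont N R hC h2 hx hq (by rw [h4, h3]))
  | succ d ih =>
    intro N R hC h2 hx hq h3 h4
    refine .natSkip rfl (by rw [hC.agents]; omega) ?_
    refine .step (s' := ⟨18, N, Function.update R 5 (oracleCdf 𝓕 (N 3) (R 0))⟩) rfl ?_
    set R₁ := Function.update R 5 (oracleCdf 𝓕 (N 3) (R 0))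
    refine .step (s' := ⟨19, N, Function.update R₁ 4 (R₁ 4 * R₁ 5)⟩) rfl ?_
    refine .step (s' := ⟨20, Function.update N 3 (N 3 + 1),
      Function.update R₁ 4 (R₁ 4 * R₁ 5)⟩) rfl ?_
    refine .natJump rfl le_rfl ?_
    refine ih _ _ ((hC.updateReal (by decide)).updateReal (by decide) |>.updateNat (by decide))
      ?_ ?_ ?_ ?_ ?_
    · simpa [Function.update_apply] using h2
    · simpa [R₁, Function.update_apply] using hx
    · simpa [R₁, Function.update_apply] using hq
    · simp only [Function.update_self]
      omega
    · simp [R₁, h4, hx, oracleUnsold, Finset.prod_range_succ]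

/-- The test of one candidate. -/
lemma haltsWithin_test {i : ℕ} {q : ℝ}
    (hQ : ∀ x, 3 / 10 < oracleUnsold 𝓕 n x → oracleUnsold 𝓕 n x < 4 / 5 → Q (x / 2))
    (hcont : ¬ (3 / 10 < oracleUnsold 𝓕 n (oracleQuantile 𝓕 i q) ∧
        oracleUnsold 𝓕 n (oracleQuantile 𝓕 i q) < 4 / 5) →
      ∀ N R, SearchConstants n N R → N 2 = i → R 2 = q →
        medianSearch.HaltsWithin 𝓕 Q ⟨11, N, R⟩ r)
    (hC : SearchConstants n N R) (h2 : N 2 = i) (hq : R 2 = q) :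
    medianSearch.HaltsWithin 𝓕 Q ⟨13, N, R⟩ (r + 5 * n + 9) := by
  set x := oracleQuantile 𝓕 i q with hx
  refine .step (s' := ⟨14, N, Function.update R 0 (oracleQuantile 𝓕 (N 2) (R 2))⟩) rfl ?_
  rw [h2, hq, ← hx]
  refine .step (s' := ⟨15, N, Function.update (Function.update R 0 x) 4 ((1 : ℚ) : ℝ)⟩) rfl ?_
  refine .step (s' := ⟨16, Function.update N 3 0,
    Function.update (Function.update R 0 x) 4 ((1 : ℚ) : ℝ)⟩) rfl ?_
  refine Program.HaltsWithin.mono (r := r + 5 + 5 * n + 1) ?_ (by omega)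
  refine haltsWithin_unsold_loop (i := i) (x := x) (q := q) ?_ n _ _
    ((hC.updateReal (by decide)).updateReal (by decide) |>.updateNat (by decide))
    (by simpa [Function.update_apply] using h2) (by simp)
    (by simpa [Function.update_apply] using hq) (by simp) (by simp [oracleUnsold])
  intro N R hC h2 hx hq h4
  by_cases hlo : 3 / 10 < oracleUnsold 𝓕 n x
  swap
  · refine .mono (.realJump rfl ?_ (hcont (fun h => hlo h.1) N R hC h2 hq)) (by omega)
    rw [h4, hC.lower]
    exact not_lt.1 hlo
  refine .realSkip rfl (by rw [h4, hC.lower]; exact hlo.not_ge) ?_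
  by_cases hhi : oracleUnsold 𝓕 n x < 4 / 5
  swap
  · refine .mono (.realJump rfl ?_ (hcont (fun h => hhi h.2) N R hC h2 hq)) (by omega)
    rw [h4, hC.upper]
    exact not_lt.1 hhi
  refine .realSkip rfl (by rw [h4, hC.upper]; exact hhi.not_ge) ?_
  set R₁ := Function.update R 4 ((1 / 2 : ℚ) : ℝ) with hR₁
  refine .step (s' := ⟨24, N, R₁⟩) rfl ?_
  refine .step (s' := ⟨25, N, Function.update R₁ 0 (R₁ 0 * R₁ 4)⟩) rfl ?_
  refine .natJump rfl le_rfl ⟨0, Nat.zero_le _, le_rfl, ?_⟩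
  have : R₁ 0 * R₁ 4 = x / 2 := by
    simp [hR₁, hx]
    ring
  simpa [this] using hQ x hlo hhi

/-- The middle loop searches the quantiles of one agent. -/
lemma haltsWithin_agent (hn : 0 < n) {i : ℕ}
    (hQ : ∀ x, 3 / 10 < oracleUnsold 𝓕 n x → oracleUnsold 𝓕 n x < 4 / 5 → Q (x / 2))
    (e : ℕ) : ∀ (k : ℕ) (N : ℕ → ℕ) (R : ℕ → ℝ), k + 1 + e = 4 * n →
      ((∀ N R, SearchConstants n N R → N 2 = i + 1 →
          medianSearch.HaltsWithin 𝓕 Q ⟨9, N, R⟩ r) ∨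
        ∃ k', k < k' ∧ k' < 4 * n ∧
          3 / 10 < oracleUnsold 𝓕 n (oracleQuantile 𝓕 i (k' / (4 * n))) ∧
          oracleUnsold 𝓕 n (oracleQuantile 𝓕 i (k' / (4 * n))) < 4 / 5) →
      SearchConstants n N R → N 2 = i → R 2 = k / (4 * n) →
      medianSearch.HaltsWithin 𝓕 Q ⟨11, N, R⟩ (r + (e + 1) * (5 * n + 11)) := by
  have hN : (0 : ℝ) < 4 * n := by positivity
  induction e with
  | zero =>
    intro k N R hk h hC h2 hR2
    -- The next level is 1, which ends the loop, so no good level can remain for this agent.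
    have h' := h.resolve_right (by rintro ⟨k', h1, h2, -⟩; omega)
    refine Program.HaltsWithin.mono (r := r + 1 + 1 + 1 + 1) ?_ (by omega)
    refine .step (s' := ⟨12, N, Function.update R 2 (R 2 + R 1)⟩) rfl ?_
    refine .realJump rfl ?_ ?_
    · have : (k : ℝ) + 1 = 4 * n := by exact_mod_cast hk
      simp only [Function.update_apply, hC.one, hC.mesh, hR2, ← add_div, this]
      simp [hN.ne']
    refine .step (s' := ⟨27, Function.update N 2 (N 2 + 1),
      Function.update R 2 (R 2 + R 1)⟩) rfl ?_
    refine .natJump rfl le_rfl (h' _ _ ((hC.updateReal (by decide)).updateNat (by decide)) ?_)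
    simp [h2]
  | succ e ih =>
    intro k N R hk h hC h2 hR2
    refine Program.HaltsWithin.mono (r := r + (e + 1) * (5 * n + 11) + 5 * n + 9 + 1 + 1) ?_
      (by ring_nf; omega)
    have hsum : R 2 + R 1 = ((k + 1 : ℕ) : ℝ) / (4 * n) := by
      rw [hR2, hC.mesh, ← add_div]
      push_cast
      rfl
    refine .step (s' := ⟨12, N, Function.update R 2 (R 2 + R 1)⟩) rfl ?_
    refine .realSkip rfl ?_ ?_
    · rw [Function.update_of_ne (by decide), hC.one, Function.update_self, hsum, not_le,
        div_lt_one hN]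
      exact_mod_cast (by omega : k + 1 < 4 * n)
    refine haltsWithin_test (i := i) hQ ?_ (hC.updateReal (by decide)) h2
      ((Function.update_self ..).trans hsum)
    intro hrej N R hC h2 hR2
    refine ih (k + 1) N R (by omega) (h.imp id ?_) hC h2 hR2
    rintro ⟨k', h1, h3, h4⟩
    refine ⟨k', lt_of_le_of_ne h1 ?_, h3, h4⟩
    rintro rfl
    exact hrej h4

/-- The outer loop searches all agents. -/
lemma haltsWithin_search (hn : 0 < n)
    (hQ : ∀ x, 3 / 10 < oracleUnsold 𝓕 n x → oracleUnsold 𝓕 n x < 4 / 5 → Q (x / 2))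
    {i k : ℕ} (hi : i < n) (hk0 : 0 < k) (hk : k < 4 * n)
    (hlo : 3 / 10 < oracleUnsold 𝓕 n (oracleQuantile 𝓕 i (k / (4 * n))))
    (hhi : oracleUnsold 𝓕 n (oracleQuantile 𝓕 i (k / (4 * n))) < 4 / 5)
    (d : ℕ) : ∀ N R, SearchConstants n N R → N 2 + d = i →
      medianSearch.HaltsWithin 𝓕 Q ⟨9, N, R⟩ ((d + 1) * (4 * n * (5 * n + 11) + 2)) := by
  induction d with
  | zero =>
    intro N R hC h2
    rw [add_zero] at h2
    refine Program.HaltsWithin.mono (r := 0 + (4 * n - 1 + 1) * (5 * n + 11) + 1 + 1) ?_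
      (by rw [Nat.sub_add_cancel (by omega)]; omega)
    refine .natSkip rfl (by rw [hC.agents]; omega) ?_
    refine .step (s' := ⟨11, N, Function.update R 2 ((0 : ℚ) : ℝ)⟩) rfl ?_
    -- At agent `i` a good level lies ahead, so no continuation is needed. Earlier agents may also
    -- pass the test, and then the program stops with an equally valid price.
    exact haltsWithin_agent hn hQ (4 * n - 1) 0 _ _ (by omega) (.inr ⟨k, hk0, hk, hlo, hhi⟩)
      (hC.updateReal (by decide)) h2 (by simp)
  | succ d ih =>
    intro N R hC h2
    refine Program.HaltsWithin.mono
      (r := (d + 1) * (4 * n * (5 * n + 11) + 2) + (4 * n - 1 + 1) * (5 * n + 11) + 1 + 1) ?_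
      (by rw [Nat.sub_add_cancel (by omega)]; ring_nf; omega)
    refine .natSkip rfl (by rw [hC.agents]; omega) ?_
    refine .step (s' := ⟨11, N, Function.update R 2 ((0 : ℚ) : ℝ)⟩) rfl ?_
    refine haltsWithin_agent hn hQ (4 * n - 1) 0 _ _ (by omega) (.inl fun N' R' hC' h' => ?_)
      (hC.updateReal (by decide)) rfl (by simp)
    exact ih N' R' hC' (by omega)

/-- The initialisation computes the mesh `1 / (4 n)` of the grid. -/
lemma haltsWithin_mesh_loop
    (hcont : ∀ N R, SearchConstants n N R → N 2 = 0 → R 0 = 0 →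
      medianSearch.HaltsWithin 𝓕 Q ⟨9, N, R⟩ r)
    (d : ℕ) : ∀ (N : ℕ → ℕ) (R : ℕ → ℝ), N 0 = n → N 1 + d = n → N 2 = 0 → R 0 = 0 →
      R 1 = 4 * N 1 → R 6 = 4 →
      medianSearch.HaltsWithin 𝓕 Q ⟨1, N, R⟩ (r + 4 + 4 * d + 1) := by
  induction d with
  | zero =>
    intro N R h0 h1 h2 hR0 hR1 hR6
    rw [add_zero] at h1
    refine .natJump rfl (by omega) ?_
    refine .step (s' := ⟨6, N, Function.update R 6 ((1 : ℚ) : ℝ)⟩) rfl ?_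
    set R₁ := Function.update R 6 ((1 : ℚ) : ℝ)
    refine .step (s' := ⟨7, N, Function.update R₁ 1 (R₁ 6 / R₁ 1)⟩) rfl ?_
    set R₂ := Function.update R₁ 1 (R₁ 6 / R₁ 1)
    refine .step (s' := ⟨8, N, Function.update R₂ 7 ((3 / 10 : ℚ) : ℝ)⟩) rfl ?_
    set R₃ := Function.update R₂ 7 ((3 / 10 : ℚ) : ℝ)
    refine .step (s' := ⟨9, N, Function.update R₃ 8 ((4 / 5 : ℚ) : ℝ)⟩) rfl ?_
    refine hcont _ _ ⟨h0, ?_, ?_, ?_, ?_⟩ h2 ?_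
    all_goals simp [R₃, R₂, R₁, hR0, hR1, h1]
  | succ d ih =>
    intro N R h0 h1 h2 hR0 hR1 hR6
    refine .natSkip rfl (by omega) ?_
    refine .step (s' := ⟨3, N, Function.update R 1 (R 1 + R 6)⟩) rfl ?_
    refine .step (s' := ⟨4, Function.update N 1 (N 1 + 1),
      Function.update R 1 (R 1 + R 6)⟩) rfl ?_
    refine .natJump rfl le_rfl ?_
    refine ih _ _ ?_ ?_ ?_ ?_ ?_ ?_
    · simpa [Function.update_apply] using h0
    · simp only [Function.update_self]
      omega
    · simpa [Function.update_apply] using h2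
    · simpa [Function.update_apply] using hR0
    · simp [hR1, hR6]
      ring
    · simpa [Function.update_apply] using hR6

lemma haltsWithin_init
    (hcont : ∀ N R, SearchConstants n N R → N 2 = 0 → R 0 = 0 →
      medianSearch.HaltsWithin 𝓕 Q ⟨9, N, R⟩ r) :
    medianSearch.HaltsWithin 𝓕 Q (Config.init n) (r + 4 + 4 * n + 1 + 1) := by
  refine .step (s' := ⟨1, Function.update (fun _ => 0) 0 n,
    Function.update (fun _ => 0) 6 ((4 : ℚ) : ℝ)⟩) rfl ?_
  refine haltsWithin_mesh_loop hcont n _ _ ?_ ?_ ?_ ?_ ?_ ?_ <;> simp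

lemma medianSearch_haltsWithin [∀ i, IsProbabilityMeasure (𝓕 i)]
    (hc : ∀ i, Continuous (cdf (𝓕 i))) (h0 : ∀ i, cdf (𝓕 i) 0 = 0) :
    medianSearch.HaltsWithin 𝓕
      (fun y => n = 0 ∧ y = 0 ∨
        ∃ x, 3 / 10 < ∏ i, cdf (𝓕 i) x ∧ ∏ i, cdf (𝓕 i) x < 4 / 5 ∧ 0 < n ∧ y = x / 2)
      (Config.init n) (n * (4 * n * (5 * n + 11) + 2) + 4 * n + 7) := by
  rcases Nat.eq_zero_or_pos n with rfl | hn
  · refine (haltsWithin_init (r := 1) fun N R hC h2 hR0 => ?_).mono (by omega)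
    refine .natJump rfl (by rw [hC.agents]; omega) ⟨0, le_rfl, le_rfl, .inl ⟨rfl, hR0⟩⟩
  · obtain ⟨i, k, hk0, hk, hlo, hhi⟩ := exists_quantile_prod_cdf_mem hn hc h0
    have hq : oracleQuantile 𝓕 i (k / (4 * n)) = quantile (𝓕 i) (k / (4 * n)) := by
      simp [oracleQuantile]
    refine (haltsWithin_init (r := n * (4 * n * (5 * n + 11) + 2)) fun N R hC h2 _ => ?_).mono
      (by omega)
    refine (haltsWithin_search hn ?_ i.2 hk0 hk ?_ ?_ i N R hC (by omega)).mono
      (Nat.mul_le_mul_right _ i.2)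
    · intro x h1 h2
      rw [oracleUnsold_eq] at h1 h2
      exact .inr ⟨x, h1, h2, hn, rfl⟩
    · rw [hq, oracleUnsold_eq]
      linarith
    · rw [hq, oracleUnsold_eq]
      linarith

end Machine

/-! ## Guarantees of the sales -/

lemma anonymousRev_div_four_le_pessSimRev (𝓕 : Fin n → Measure ℝ)
    [∀ i, IsProbabilityMeasure (𝓕 i)] (p : ℝ≥0) :
    anonymousRev 𝓕 p / 4 ≤ pessSimRev fullExt 𝓕 fun _ => (p : ℝ≥0∞) / 2 :=
  le_iInf₂ fun _ hT => (anonymousRev_div_four_le 𝓕 p).trans (le_simRev hT)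

/-- One bound `B` on `soloRev` dominates both benchmarks, so the same price serves both sales. -/
lemma medianSearch_correct (𝓕 : Fin n → Measure ℝ) [∀ i, IsProbabilityMeasure (𝓕 i)]
    (h0 : ∀ i, 𝓕 i (Set.Iio 0) = 0) (hreg : ∀ i, IsRegular (𝓕 i)) :
    ∃ p : ℝ≥0, medianSearch.ComputesWithin 𝓕 (n * (4 * n * (5 * n + 11) + 2) + 4 * n + 7) p ∧
      ∃ B : ℝ≥0∞, (∀ T, soloRev 𝓕 T Finset.univ ≤ B) ∧
        B / ENNReal.ofReal (4 * Real.exp 1) ≤ p * min (1 / 2) (1 - ∏ i, F (𝓕 i) (2 * p)) := by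
  have ha := fun i => (hreg i).singleton_eq_zero
  obtain ⟨m, hm, hpc, hout⟩ := medianSearch_haltsWithin (fun i => continuous_cdf (ha i))
    fun i => cdf_zero (h0 i) (ha i)
  rcases hout with ⟨rfl, hout⟩ | ⟨x, hlo, hhi, hn, hout⟩
  -- Without agents the product is 1 at every price and nothing is searched; the output is 0 and all
  -- revenues vanish.
  · exact ⟨0, ⟨m, hm, hpc, hout⟩, 0, fun T => by simp [soloRev], by simp⟩
  · have hx : 0 ≤ x := by
      by_contra hx
      rw [Finset.prod_eq_zero (Finset.mem_univ (⟨0, hn⟩ : Fin n))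
        (cdf_eq_zero_of_neg (h0 _) (not_le.1 hx))] at hlo
      norm_num at hlo
    lift x to ℝ≥0 using hx
    exact ⟨x / 2, ⟨m, hm, hpc, by rw [hout]; push_cast; rfl⟩, _,
      fun T => soloRev_le h0 hreg x.2 ((by norm_num : (0 : ℝ) < 3 / 10).trans hlo) T,
      benchmark_div_le hlo hhi⟩

end SocialGoods

end

open SocialGoods in
theorem mainTheorem4 :
    -- the anonymous private-good price `p`, halved, in the simultaneous sale
    (∀ (n : ℕ) (𝓕 : Fin n → Measure ℝ), (∀ i, IsProbabilityMeasure (𝓕 i)) →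
      (∀ i, 𝓕 i (Set.Iio 0) = 0) → (∀ i v, 𝓕 i {v} = 0) → ∀ p : ℝ≥0,
        (simEq fullExt 𝓕 (fun _ => (p : ℝ≥0∞) / 2)).Nonempty ∧
        anonymousRev 𝓕 p / 4 ≤ pessSimRev fullExt 𝓕 (fun _ => (p : ℝ≥0∞) / 2)) ∧
    -- the same in the sequential sale, for every arrival order
    (∀ (n : ℕ) (𝓕 : Fin n → Measure ℝ), (∀ i, IsProbabilityMeasure (𝓕 i)) →
      (∀ i, 𝓕 i (Set.Iio 0) = 0) → ∀ (p : ℝ≥0) (σ : Equiv.Perm (Fin n)),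
        anonymousRev 𝓕 p / 4 ≤ seqRev fullExt 𝓕 σ (fun _ => (p : ℝ≥0∞) / 2)) ∧
    -- one polynomial-time program computes a good single price for all regular distributions
    (∃ (P : Program) (B : Polynomial ℕ), ∀ (n : ℕ) (𝓕 : Fin n → Measure ℝ),
      (∀ i, IsProbabilityMeasure (𝓕 i)) → (∀ i, 𝓕 i (Set.Iio 0) = 0) →
      (∀ i, IsRegular (𝓕 i)) →
      ∃ p : ℝ≥0, P.ComputesWithin 𝓕 (B.eval n) p ∧
        (simEq fullExt 𝓕 (fun _ => (p : ℝ≥0∞))).Nonempty ∧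
        simOpt fullExt 𝓕 / ENNReal.ofReal (4 * Real.exp 1) ≤
          pessSimRev fullExt 𝓕 (fun _ => (p : ℝ≥0∞)) ∧
        ∀ σ σ' : Equiv.Perm (Fin n),
          seqOpt fullExt 𝓕 σ' / ENNReal.ofReal (4 * Real.exp 1) ≤
            seqRev fullExt 𝓕 σ (fun _ => (p : ℝ≥0∞))) := by
  refine ⟨fun n 𝓕 hp h0 ha p => ⟨?_, anonymousRev_div_four_le_pessSimRev 𝓕 p⟩,
    fun n 𝓕 hp h0 p σ => (anonymousRev_div_four_le 𝓕 p).trans (le_seqRev σ _), medianSearch,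
    .X * (4 * .X * (5 * .X + 11) + 2) + 4 * .X + 7, fun n 𝓕 hp h0 hreg => ?_⟩
  · have := simEq_nonempty h0 ha (p / 2)
    rwa [ENNReal.coe_div two_ne_zero] at this
  · obtain ⟨p, hcomp, B, hB, hle⟩ := medianSearch_correct 𝓕 h0 hreg
    refine ⟨p, by simpa using hcomp,
      simEq_nonempty h0 (fun i => (hreg i).singleton_eq_zero) p, ?_, fun σ σ' => ?_⟩
    · exact le_iInf₂ fun T hT =>
        ((ENNReal.div_le_div_right (simOpt_le hB) _).trans hle).trans (le_simRev hT)
    · exact ((ENNReal.div_le_div_right (seqOpt_le hB σ') _).trans hle).trans (le_seqRev σ p)
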